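/- Let $S=(s_1,s_2,\dots)$ be an infinite sequence of positive integers. It is \emph{doubly fractal} if every positive integer occurs in $S$, $s_1=1$, and $S$ is equal both to the sequence that remains when the first occurrence of every positive integer is removed from $S$ (upper trimming) and to the sequence that remains when $1$ is subtracted from every term of $S$ and all zeros are then removed (lower trimming). \emph{The construction procedure.} Fix $n\ge 2$. For a finite sequence $S$ let $\ell_S$ be the least positive integer that does not appear in $S$, let $I_k(v)$ be the position of the $k$-th occurrence of $v$ in $S$, let $\mathrm{Indx}_X(v)$ be the position of $v$ in a sequence $X$, and call the part of $S$ from the $k$-th $1$ to the $k$-th $n$ (inclusive) the $k$-th block. The integers $1,\dots,n$ are the main terms. (Type 1.) Start with $(1,2,\dots,n)$ and extend it to two blocks, $$S=(1,2,\dots,n,\,1,n+1,2,n+2,\dots,n-1,2n-1,n).$$ Given $S$ with $k\ge 2$ blocks, the next block is built as follows. Put $\ell=\ell_S$, $$t=\bigl(S(I_k(n-1)+1)+1,\dots,S(I_k(n)-1)+1\bigr),\qquad t'=\bigl(S(I_{k-1}(n)+1),\dots,S(I_{k-1}(n+1)-1)\bigr).$$ Merge $t$ and $t'$ into a sequence $P$: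 write down $t'$ without its term $1$; if $\mathrm{Indx}_t(\ell)=\mathrm{Indx}_{t'}(1)$, insert at this position one of $(1,\ell)$ and $(\ell,1)$, chosen freely; otherwise insert $\ell$ and $1$ simultaneously, at the places that are numbered $\mathrm{Indx}_t(\ell)$ and $\mathrm{Indx}_{t'}(1)$ relative to the terms written down. Put $d=\mathrm{Indx}_P(1)-\mathrm{Indx}_P(\ell)$. Append to $S$ the terms of $P$ that precede $1$. Then append a copy of the $k$-th block into which, for each main term $m=1,\dots,n$ in turn, the current (new) $\ell_S$ is inserted at the position with $\mathrm{Indx}(\ell_S)=\mathrm{Indx}(m)-d$ (positions after the insertion), if and only if this position lies between the initial $1$ and the final $n$ of the block being written. Repeating this step indefinitely yields an infinite sequence. (Type 2.) Let $S'=(s'_1,s'_2,\dots)$ be an infinite sequence obtained in this way from $(1,\dots,n)$. Start with $(1,\dots,1,2)$, with $n$ ones, and set $S(k)=\#\{\,i : 1\le i\le k,\ s'_i=s'_k\,\}$ for $k>n+1$. \textbf{Theorem.} Every doubly fractal sequence arises from the construction procedure, of type 1 or of type 2, for some $n\ge2$ and some choices of $(1,\ell)$ or $(\ell,1)$ in the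 steps where a choice is offered. Conversely, for all $n\ge 2$ and all such choices, the sequences of both types produced by the procedure are doubly fractal. -/

import Mathlib

namespace DoublyFractal

/-! Infinite sequences `(s₁, s₂, s₃, …)` of positive integers are functions `S : ℕ → ℕ` with
`S i = s_{i+1}`; finite sequences are lists.  All positions below are counted from `0`. -/

/-- `T` is the (infinite) sequence that remains when the terms of `S` at positions outside `K` are
removed and `f` is applied to the remaining terms. -/
def IsRemaining (S : ℕ → ℕ) (K : Set ℕ) (f : ℕ → ℕ) (T : ℕ → ℕ) : Prop :=
  ∃ φ : ℕ → ℕ, StrictMono φ ∧ Set.range φ = K ∧ ∀ k, T k = f (S (φ k))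

/-- `T` is the upper trimmed sequence of `S`: remove every first occurrence. -/
def IsUpperTrim (S T : ℕ → ℕ) : Prop :=
  IsRemaining S {k | ∃ i < k, S i = S k} id T

/-- `T` is the lower trimmed sequence of `S`: subtract `1` from every term, then remove all
zeros. -/
def IsLowerTrim (S T : ℕ → ℕ) : Prop :=
  IsRemaining S {k | S k - 1 ≠ 0} (fun s => s - 1) T

/-- Doubly fractal sequences of positive integers. -/
structure IsDoublyFractal (S : ℕ → ℕ) : Prop where
  pos : ∀ k, 0 < S k
  occurs : ∀ v, 0 < v → ∃ k, S k = v
  first : S 0 = 1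
  upper : IsUpperTrim S S
  lower : IsLowerTrim S S

/-! ### The construction procedure -/

theorem exists_pos_notMem (S : List ℕ) : ∃ m, 0 < m ∧ m ∉ S := by
  refine ⟨S.sum + 1, Nat.succ_pos _, fun h => ?_⟩
  have := List.le_sum_of_mem h
  omega

/-- `ℓ_S`, the least positive integer that does not appear in `S`. -/
def ell (S : List ℕ) : ℕ := Nat.find (exists_pos_notMem S)

/-- `I_k(v)` for `k ≥ 1`: the position of the `k`-th occurrence of `v` in `S`. -/
def occ (S : List ℕ) (k v : ℕ) : ℕ := S.idxOfNth v (k - 1)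

/-- The terms of `S` at positions strictly between `i` and `j`. -/
def between (S : List ℕ) (i j : ℕ) : List ℕ := (S.take j).drop (i + 1)

/-- The `k`-th block of `S`: from the `k`-th `1` to the `k`-th `n`, inclusive. -/
def block (n k : ℕ) (S : List ℕ) : List ℕ := (S.take (occ S k n + 1)).drop (occ S k 1)

/-- The first two blocks `(1, 2, …, n, 1, n+1, 2, n+2, …, n-1, 2n-1, n)`. -/
def firstTwoBlocks (n : ℕ) : List ℕ :=
  List.range' 1 n ++ (List.range' 1 (n - 1)).flatMap (fun m => [m, n + m]) ++ [n]

/-- The auxiliary sequence `t`: the terms between the `k`-th `n-1` and the `k`-th `n`, each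
increased by `1`. -/
def seqT (n k : ℕ) (S : List ℕ) : List ℕ :=
  (between S (occ S k (n - 1)) (occ S k n)).map (· + 1)

/-- The auxiliary sequence `t'`: the terms between the `(k-1)`-th `n` and the `(k-1)`-th `n+1`. -/
def seqT' (n k : ℕ) (S : List ℕ) : List ℕ :=
  between S (occ S (k - 1) n) (occ S (k - 1) (n + 1))

/-- The sequence `P` merged from `t` and `t'`: from `t'` without its `1`, by inserting `ℓ` and `1`
in the places they have in `t` and `t'`.  If these places agree, there are two possibilities:
`(1, ℓ)` if `oneFirst` is true and `(ℓ, 1)` otherwise. -/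
def merge (oneFirst : Bool) (ℓ : ℕ) (t t' : List ℕ) : List ℕ :=
  let rest := t'.erase 1
  let i := t.idxOf ℓ
  let j := t'.idxOf 1
  if i = j then rest.take i ++ (if oneFirst then [1, ℓ] else [ℓ, 1]) ++ rest.drop i
  else if i < j then (rest.insertIdx j 1).insertIdx i ℓ
  else (rest.insertIdx i ℓ).insertIdx j 1

/-- `d = Indx_P(1) - Indx_P(ℓ)`. -/
def shift (ℓ : ℕ) (P : List ℕ) : ℤ := (P.idxOf 1 : ℤ) - (P.idxOf ℓ : ℤ)

/-- Treatment of the main term `m` in the block `W` that is being written after `R`: the new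
`ℓ_S` is inserted so that, after the insertion, its position is `d` less than that of `m`,
provided that this position lies in the block, between its initial `1` and its final `n`.
(If `d > 0`, then `ℓ_S` comes before `m` and its insertion moves `m` by one place; an insertion at
place `0` of `W` would come before the initial `1`, and one at place `W.length` or later would
come after the final `n`.) -/
def insertNew (d : ℤ) (R W : List ℕ) (m : ℕ) : List ℕ :=
  let q : ℤ := if 0 < d then (W.idxOf m : ℤ) + 1 - d else (W.idxOf m : ℤ) - d
  if 1 ≤ q ∧ q < (W.length : ℤ) then W.insertIdx q.toNat (ell (R ++ W)) else W

/-- One step of the procedure, from `k ≥ 2` blocks to `k + 1` blocks: append the terms of `P` that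
precede `1`, then rewrite the last block, inserting a new `ℓ_S` for each main term `1, …, n` in
turn. -/
def extend (n k : ℕ) (oneFirst : Bool) (S : List ℕ) : List ℕ :=
  let ℓ := ell S
  let P := merge oneFirst ℓ (seqT n k S) (seqT' n k S)
  let R := S ++ P.take (P.idxOf 1)
  R ++ (List.range' 1 n).foldl (insertNew (shift ℓ P) R) (block n k S)

/-- The finite sequence with `b + 2` blocks built by the procedure, where `c b` is the choice made
at the step from `b + 2` to `b + 3` blocks. -/
def stage (n : ℕ) (c : ℕ → Bool) : ℕ → List ℕ
  | 0 => firstTwoBlocks n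
  | b + 1 => extend n (b + 2) (c b) (stage n c b)

/-- The infinite sequence with initial segment `(1, …, n)` built by the procedure.  Every stage is
an initial segment of the next one, and stage `i` has more than `i` terms. -/
def typeOne (n : ℕ) (c : ℕ → Bool) (i : ℕ) : ℕ := (stage n c i).getD i 0

/-- The infinite sequence with initial segment `(1, …, 1, 2)`, with `n` ones, built from the
sequence `S'` that starts with `(1, …, n)`: its further terms are
`S(k) = #{i ≤ k : s'_i = s'_k}`. -/
def typeTwo (n : ℕ) (S' : ℕ → ℕ) (k : ℕ) : ℕ :=
  if k < n then 1
  else if k = n then 2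
  else ((Finset.range (k + 1)).filter (fun i => S' i = S' k)).card

/-- `S` arises from the construction procedure, for some `n ≥ 2` and some choices. -/
def IsConstructed (S : ℕ → ℕ) : Prop :=
  ∃ n : ℕ, 2 ≤ n ∧ ∃ c : ℕ → Bool, S = typeOne n c ∨ S = typeTwo n (typeOne n c)

end DoublyFractal

namespace DoublyFractal

/-! ### Lists that are strictly sorted by a key -/

/-! Record each term of a doubly fractal sequence as a pair: its value minus one, and the number of
earlier occurrences of that value. This enumerates `ℕ × ℕ`. The terms that survive upper trimming
are the image of the sequence under translation by `(0, 1)`, and those that survive lower trimming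
are its image under translation by `(1, 0)`. Being doubly fractal therefore means that the order of
enumeration starts at `(0, 0)` and is invariant under translations (`IsDoublyFractal.exists_enum`,
`IsMonoidEnum.isDoublyFractal`). Exchanging coordinates preserves such orders and interchanges the
two types, so one may assume that `(1, 0)` precedes `(0, 1)`. Then `n = N + 2` is determined by `(n
- 1, 0) < (0, 1) < (n, 0)`.

For such an order, one step of the procedure recovers the next initial segment
(`IsTypeOneEnum.extend_eq`). The window between the `k`-th `n` and the `k`-th `n + 1` is known from
its two translated predecessors `t` and `t'`, except possibly for the order of the new value `(l,
0)` and the new one `(0, k)`. The rest of the block is the previous block translated by `(0, 1)`,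
together with new values `(l + m, 0)`, which lie relative to `(m, k)` as `(l, 0)` lies relative to
`(0, k)`. Reading the choices off the order gives the first half of the theorem.

Conversely, every sequence of choices must come from such an order. Each finite stage is realised by
ordering the pairs by `a + b θ` with `θ` irrational. If a free choice disagrees with the current
`θ`, then `θ` is moved just across `l / k`; as no pair with positive coordinates separates `(0, k)`
from `(l, 0)`, the part already built is unchanged (`exists_exchange`). The stages agree on growing
initial segments, and their limit is the required order (`exists_enum_of_choices`). -/

theorem pairwise_insertIdx_countP {α : Type*} (f : α → ℕ) (x : α) (L : List α)
    (hL : L.Pairwise (fun a b => f a < f b)) (hx : ∀ y ∈ L, f y ≠ f x) :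
    (L.insertIdx (L.countP (fun y => f y < f x)) x).Pairwise (fun a b => f a < f b) := by
  induction L with
  | nil => simp
  | cons a L ih =>
    rw [List.pairwise_cons] at hL
    have ha := hx a (by simp)
    by_cases h : f a < f x
    · rw [List.countP_cons_of_pos (by simpa using h), List.insertIdx_succ_cons, List.pairwise_cons]
      refine ⟨fun y hy => ?_, ih hL.2 fun y hy => hx y (by simp [hy])⟩
      rcases List.eq_or_mem_of_mem_insertIdx hy with rfl | hy
      · exact h
      · exact hL.1 y hy
    · have h0 : (a :: L).countP (fun y => f y < f x) = 0 := by
        rw [List.countP_eq_zero]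
        intro y hy
        rcases List.mem_cons.1 hy with rfl | hy
        · simpa using h
        · have := hL.1 y hy
          simp only [decide_eq_true_eq]; omega
      rw [h0, List.insertIdx_zero, List.pairwise_cons, List.pairwise_cons]
      refine ⟨fun y hy => ?_, hL⟩
      rcases List.mem_cons.1 hy with rfl | hy
      · omega
      · have := hL.1 y hy; omega

theorem idxOf_eq_countP {α : Type*} [BEq α] [LawfulBEq α] (f : α → ℕ) (x : α) (L : List α)
    (hL : L.Pairwise (fun a b => f a < f b)) (hx : x ∈ L) :
    L.idxOf x = L.countP (fun y => f y < f x) := by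
  induction L with
  | nil => simp at hx
  | cons a L ih =>
    rw [List.pairwise_cons] at hL
    by_cases h : a = x
    · subst h
      rw [List.idxOf_cons_self, eq_comm, List.countP_eq_zero]
      intro y hy
      rcases List.mem_cons.1 hy with rfl | hy
      · simp
      · have := hL.1 y hy
        simp only [decide_eq_true_eq]; omega
    · have hxL : x ∈ L := by
        rcases List.mem_cons.1 hx with rfl | hx
        · exact absurd rfl h
        · exact hx
      rw [List.idxOf_cons_ne _ h, List.countP_cons_of_pos (by simpa using hL.1 x hxL),
        ih hL.2 hxL]

theorem idxOf_map_of_unique {α : Type*} [BEq α] [LawfulBEq α] (g : α → ℕ) (x : α) (L : List α)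
    (hx : ∀ y ∈ L, g y = g x → y = x) : (L.map g).idxOf (g x) = L.idxOf x := by
  induction L with
  | nil => simp
  | cons a L ih =>
    have ih := ih fun y hy => hx y (by simp [hy])
    by_cases h : a = x
    · subst h; simp
    · rw [List.map_cons, List.idxOf_cons_ne _ h,
        List.idxOf_cons_ne _ fun h' => h (hx a (by simp) h'), ih]

theorem erase_map_of_unique {α : Type*} [BEq α] [LawfulBEq α] (g : α → ℕ) (x : α) (L : List α)
    (hx : ∀ y ∈ L, g y = g x → y = x) : (L.map g).erase (g x) = (L.erase x).map g := by
  induction L with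
  | nil => simp
  | cons a L ih =>
    have ih := ih fun y hy => hx y (by simp [hy])
    by_cases h : a = x
    · subst h; simp
    · have h' : g a ≠ g x := fun h' => h (hx a (by simp) h')
      rw [List.map_cons, List.erase_cons_tail (by simpa using h'),
        List.erase_cons_tail (by simpa using h), ih, List.map_cons]

theorem eq_of_sorted {α : Type*} (f : α → ℕ) {L M : List α}
    (hL : L.Pairwise (fun a b => f a < f b)) (hM : M.Pairwise (fun a b => f a < f b))
    (h : ∀ x, x ∈ L ↔ x ∈ M) : L = M :=
  haveI : Std.Irrefl (fun a b : α => f a < f b) := ⟨fun _ => lt_irrefl _⟩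
  haveI : Std.Asymm (fun a b : α => f a < f b) := ⟨fun _ _ => lt_asymm⟩
  List.Pairwise.eq_of_mem_iff hL hM h

theorem nodup_of_sorted {α : Type*} (f : α → ℕ) {L : List α}
    (hL : L.Pairwise (fun a b => f a < f b)) : L.Nodup :=
  hL.imp fun h e => by subst e; exact lt_irrefl _ h

theorem erase_eq_filter_of_sorted {α : Type*} [BEq α] [LawfulBEq α] (f : α → ℕ) (x : α) {L : List α}
    (hL : L.Pairwise (fun a b => f a < f b)) : L.erase x = L.filter (· != x) := by
  exact (nodup_of_sorted f hL).erase_eq_filter x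

theorem countP_insertIdx {α : Type*} (p : α → Bool) (x : α) (L : List α) (i : ℕ)
    (hi : i ≤ L.length) : (L.insertIdx i x).countP p = L.countP p + if p x then 1 else 0 := by
  rw [(List.perm_insertIdx x L hi).countP_eq, List.countP_cons]

theorem map_insertIdx' {α β : Type*} (g : α → β) (x : α) (L : List α) (i : ℕ) :
    (L.insertIdx i x).map g = (L.map g).insertIdx i (g x) := by
  induction L generalizing i with
  | nil => cases i <;> simp
  | cons a L ih => cases i <;> simp [ih]

theorem take_append_cons_drop {α : Type*} (x : α) (L : List α) (i : ℕ) (hi : i ≤ L.length) :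
    L.take i ++ x :: L.drop i = L.insertIdx i x := by
  induction L generalizing i with
  | nil =>
    obtain rfl : i = 0 := by simpa using hi
    simp
  | cons a L ih =>
    cases i with
    | zero => simp
    | succ i => simpa using ih i (by simpa using hi)

theorem idxOfNth_eq {l : List ℕ} {x i j : ℕ} (hi : l[i]? = some x)
    (hj : (l.take i).count x = j) : l.idxOfNth x j = i := by
  induction l generalizing i j with
  | nil => simp at hi
  | cons a l ih =>
    cases i with
    | zero =>
      simp at hi hj
      subst hi hj
      simp
    | succ i =>
      simp only [List.getElem?_cons_succ] at hi
      simp only [List.take_succ_cons, List.count_cons] at hj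
      by_cases h : a = x
      · subst h
        simp only [beq_self_eq_true, if_true] at hj
        subst hj
        rw [List.idxOfNth_cons_succ_of_beq (by simp), ih hi rfl]
      · have h' : (a == x) = false := by simpa using h
        rw [h'] at hj
        rw [List.idxOfNth_cons_of_not_beq h', ih hi (by simpa using hj)]

/-- Merging inserts the two new elements where the order demands it. -/
theorem exists_sorted_merge {α : Type*} (f g : α → ℕ) (x y : α) (C : List α) (o : Bool)
    (t t' : List ℕ) (hC : C.Pairwise (fun a b => f a < f b)) (hx : ∀ a ∈ C, f a ≠ f x)
    (hy : ∀ a ∈ C, f a ≠ f y) (hxy : f x ≠ f y) (hg : g x = 1)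
    (ht' : t'.erase 1 = C.map g) (hi : t.idxOf (g y) = C.countP (fun a => f a < f y))
    (hj : t'.idxOf 1 = C.countP (fun a => f a < f x))
    (ho : t.idxOf (g y) = t'.idxOf 1 → (o = true ↔ f x < f y)) :
    ∃ L : List α, L.Pairwise (fun a b => f a < f b) ∧
      (∀ a, a ∈ L ↔ a = x ∨ a = y ∨ a ∈ C) ∧ merge o (g y) t t' = L.map g := by
  rw [hi, hj] at ho
  have key : ∀ x y : α, (∀ a ∈ C, f a ≠ f x) → (∀ a ∈ C, f a ≠ f y) → f x < f y →
      ((C.insertIdx (C.countP fun a => f a < f y) y).insertIdx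
        (C.countP fun a => f a < f x) x).Pairwise (fun a b => f a < f b) ∧
      (∀ a, a ∈ ((C.insertIdx (C.countP fun a => f a < f y) y).insertIdx
        (C.countP fun a => f a < f x) x) ↔ a = x ∨ a = y ∨ a ∈ C) := by
    intro x y hx hy hxy
    have hle : (C.countP fun a => f a < f y) ≤ C.length := List.countP_le_length
    have hle' : (C.countP fun a => f a < f x) ≤ C.length := List.countP_le_length
    -- The larger element goes in first, so it does not shift the place of the smaller one.
    have hc : (C.insertIdx (C.countP fun a => f a < f y) y).countP (fun a => f a < f x) =
        C.countP (fun a => f a < f x) := by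
      rw [countP_insertIdx _ _ _ _ hle, if_neg (by simp; omega), add_zero]
    constructor
    · conv in List.insertIdx _ _ x => rw [← hc]
      refine pairwise_insertIdx_countP f x _ (pairwise_insertIdx_countP f y C hC hy) fun a ha => ?_
      rcases List.eq_or_mem_of_mem_insertIdx ha with rfl | ha
      · omega
      · exact hx a ha
    · intro a
      rw [List.mem_insertIdx (by rw [List.length_insertIdx]; split <;> omega),
        List.mem_insertIdx hle]
  have hle : (C.countP fun a => f a < f y) ≤ C.length := List.countP_le_length
  have hle' : (C.countP fun a => f a < f x) ≤ C.length := List.countP_le_length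
  rcases lt_or_gt_of_ne hxy with h | h
  · have hmono : (C.countP fun a => f a < f x) ≤ C.countP fun a => f a < f y :=
      List.countP_mono_left fun a _ ha => by
        simp only [decide_eq_true_eq] at ha ⊢; omega
    obtain ⟨h1, h2⟩ := key x y hx hy h
    refine ⟨_, h1, h2, ?_⟩
    simp only [merge, hi, hj, ht']
    rw [map_insertIdx', map_insertIdx', hg]
    split_ifs with h3 h4 h5
    · rw [h3, ← take_append_cons_drop _ (List.map g C) _ (by simp [hle']),
        ← take_append_cons_drop _ _ _ (by simp; omega)]
      simp [hle']
    · exact absurd ((ho h3).2 h) h4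
    · omega
    · rfl
  · have hmono : (C.countP fun a => f a < f y) ≤ C.countP fun a => f a < f x :=
      List.countP_mono_left fun a _ ha => by
        simp only [decide_eq_true_eq] at ha ⊢; omega
    obtain ⟨h1, h2⟩ := key y x hy hx h
    refine ⟨_, h1, fun a => by rw [h2]; tauto, ?_⟩
    simp only [merge, hi, hj, ht']
    rw [map_insertIdx', map_insertIdx', hg]
    split_ifs with h3 h4 h5
    · have := (ho h3).1 h4; omega
    · rw [h3, ← take_append_cons_drop _ (List.map g C) _ (by simp [hle']),
        ← take_append_cons_drop _ _ _ (by simp; omega)]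
      simp [hle']
    · rfl
    · omega

/-! ### Translation-invariant enumerations of `ℕ × ℕ` -/

/-- An enumeration of `ℕ × ℕ` that starts with `(0, 0)` and whose order of enumeration is invariant
under translations. -/
structure IsMonoidEnum (E : ℕ ≃ ℕ × ℕ) : Prop where
  zero : E 0 = (0, 0)
  fst : ∀ p q, E.symm p < E.symm q → E.symm (p.1 + 1, p.2) < E.symm (q.1 + 1, q.2)
  snd : ∀ p q, E.symm p < E.symm q → E.symm (p.1, p.2 + 1) < E.symm (q.1, q.2 + 1)

/-- The value of a pair: the first coordinate, counted from `1`. -/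
def val (p : ℕ × ℕ) : ℕ := p.1 + 1

/-- The pairs enumerated at positions `a ≤ i < b`. -/
def seg (E : ℕ ≃ ℕ × ℕ) (a b : ℕ) : List (ℕ × ℕ) := (List.range' a (b - a)).map E

theorem mem_seg {E : ℕ ≃ ℕ × ℕ} {a b : ℕ} {p : ℕ × ℕ} :
    p ∈ seg E a b ↔ a ≤ E.symm p ∧ E.symm p < b := by
  simp only [seg, List.mem_map, List.mem_range'_1]
  constructor
  · rintro ⟨i, hi, rfl⟩
    rw [E.symm_apply_apply]; omega
  · intro hp
    exact ⟨E.symm p, by omega, E.apply_symm_apply p⟩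

theorem sorted_seg (E : ℕ ≃ ℕ × ℕ) (a b : ℕ) :
    (seg E a b).Pairwise (fun p q => E.symm p < E.symm q) := by
  rw [seg, List.pairwise_map]
  simpa using List.pairwise_lt_range' (s := a) (n := b - a)

theorem seg_append (E : ℕ ≃ ℕ × ℕ) {a b c : ℕ} (hab : a ≤ b) (hbc : b ≤ c) :
    seg E a b ++ seg E b c = seg E a c := by
  refine eq_of_sorted E.symm ?_ (sorted_seg E a c) fun p => ?_
  · rw [List.pairwise_append]
    refine ⟨sorted_seg E _ _, sorted_seg E _ _, fun p hp q hq => ?_⟩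
    rw [mem_seg] at hp hq; omega
  · rw [List.mem_append, mem_seg, mem_seg, mem_seg]; omega

theorem length_seg (E : ℕ ≃ ℕ × ℕ) (a b : ℕ) : (seg E a b).length = b - a := by simp [seg]

theorem take_seg (E : ℕ ≃ ℕ × ℕ) (a b i : ℕ) (h : a + i ≤ b) :
    (seg E a b).take i = seg E a (a + i) := by
  rw [← seg_append E (Nat.le_add_right a i) h, List.take_append_of_le_length, List.take_of_length_le]
  all_goals rw [length_seg]; omega

theorem drop_seg (E : ℕ ≃ ℕ × ℕ) (b i : ℕ) : (seg E 0 b).drop i = seg E i b := by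
  rcases le_total i b with h | h
  · rw [← seg_append E (Nat.zero_le i) h, List.drop_append_of_le_length, List.drop_of_length_le]
    · simp
    all_goals rw [length_seg]; omega
  · rw [List.drop_of_length_le (by rw [length_seg]; omega)]
    simp [seg, Nat.sub_eq_zero_of_le h]

theorem idxOf_seg (E : ℕ ≃ ℕ × ℕ) {a b : ℕ} {p : ℕ × ℕ} (hp : p ∈ seg E a b) :
    (seg E a b).idxOf p = E.symm p - a := by
  have h := mem_seg.1 hp
  rw [idxOf_eq_countP E.symm p _ (sorted_seg E a b) hp, List.countP_eq_length_filter,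
    ← length_seg E a (E.symm p)]
  congr 1
  refine eq_of_sorted E.symm ((sorted_seg E a b).filter _) (sorted_seg E _ _) fun q => ?_
  rw [List.mem_filter, mem_seg, mem_seg, decide_eq_true_eq]; omega

theorem map_val_succ (L : List (ℕ × ℕ)) :
    (L.map val).map (· + 1) = (L.map fun p => (p.1 + 1, p.2)).map val := by
  simp [val, Function.comp_def]

theorem map_val_snd (L : List (ℕ × ℕ)) :
    L.map val = (L.map fun p => (p.1, p.2 + 1)).map val := by
  simp [val, Function.comp_def]

theorem ell_map_val (L : List (ℕ × ℕ)) (v : ℕ) (h : ∀ u < v, ∃ p ∈ L, p.1 = u)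
    (h' : ∀ p ∈ L, p.1 ≠ v) : ell (L.map val) = v + 1 := by
  rw [ell, Nat.find_eq_iff]
  refine ⟨⟨Nat.succ_pos v, fun hm => ?_⟩, fun u hu hn => ?_⟩
  · obtain ⟨p, hp, hpv⟩ := List.mem_map.1 hm
    exact h' p hp (by simpa [val] using hpv)
  · obtain ⟨u, rfl⟩ : ∃ w, u = w + 1 := ⟨u - 1, by omega⟩
    obtain ⟨p, hp, hpu⟩ := h u (by omega)
    exact hn.2 (List.mem_map.2 ⟨p, hp, by simp [val, hpu]⟩)

/-- Only finitely many positions precede that of `p`, while the pairs `(v, 0)` are infinitely many.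
-/
theorem exists_lt_symm (E : ℕ ≃ ℕ × ℕ) (p : ℕ × ℕ) : ∃ v, E.symm p < E.symm (v, 0) := by
  by_contra! hn
  have : Function.Injective fun v : Fin (E.symm p + 2) =>
      (⟨E.symm (v, 0), Nat.lt_succ_of_le (hn v)⟩ : Fin (E.symm p + 1)) := by
    intro a b hab
    have := E.symm.injective (Fin.mk.inj hab)
    exact Fin.ext (Prod.mk.inj this).1
  have := Fintype.card_le_of_injective _ this
  simp at this

/-! ### Order calculus for translation-invariant enumerations. -/

namespace IsMonoidEnum

variable {E : ℕ ≃ ℕ × ℕ}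

theorem symm_zero (h : IsMonoidEnum E) : E.symm (0, 0) = 0 := by
  rw [E.symm_apply_eq, h.zero]

theorem add_lt (h : IsMonoidEnum E) {a b c d : ℕ} (hlt : E.symm (a, b) < E.symm (c, d))
    (r s : ℕ) : E.symm (a + r, b + s) < E.symm (c + r, d + s) := by
  have h1 : ∀ r, E.symm (a + r, b) < E.symm (c + r, d) := by
    intro r
    induction r with
    | zero => exact hlt
    | succ r ih => exact h.fst _ _ ih
  induction s with
  | zero => exact h1 r
  | succ s ih => exact h.snd _ _ ih

/-- The order of two pairs depends on their difference only. -/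
theorem transfer (h : IsMonoidEnum E) {a b c d : ℕ} (hlt : E.symm (a, b) < E.symm (c, d))
    (a' b' c' d' : ℕ) (h1 : a + c' = a' + c) (h2 : b + d' = b' + d) :
    E.symm (a', b') < E.symm (c', d') := by
  by_contra hn
  rcases (not_lt.1 hn).lt_or_eq with hn | hn
  · have k1 := h.add_lt hlt c' d'
    have k2 := h.add_lt hn c d
    rw [h1, h2, add_comm c c', add_comm d d'] at k1
    exact lt_asymm k1 k2
  · obtain ⟨rfl, rfl⟩ := Prod.mk.inj (E.symm.injective hn)
    have : a = c := by omega
    have : b = d := by omega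
    subst_vars
    exact lt_irrefl _ hlt

theorem lt_of_lt (h : IsMonoidEnum E) {a b c d : ℕ} (h1 : a ≤ c) (h2 : b ≤ d)
    (h3 : a < c ∨ b < d) : E.symm (a, b) < E.symm (c, d) := by
  refine h.transfer (a := 0) (b := 0) (c := c - a) (d := d - b) ?_ _ _ _ _ (by omega) (by omega)
  rw [h.symm_zero, Nat.pos_iff_ne_zero, ← h.symm_zero]
  intro he
  have := Prod.mk.inj (E.symm.injective he)
  omega

theorem le_of_le (h : IsMonoidEnum E) {a b c d : ℕ} (h1 : a ≤ c) (h2 : b ≤ d) :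
    E.symm (a, b) ≤ E.symm (c, d) := by
  by_cases h3 : a < c ∨ b < d
  · exact (h.lt_of_lt h1 h2 h3).le
  · obtain rfl : a = c := by omega
    obtain rfl : b = d := by omega
    exact le_rfl

/-- Invariance forces `(v, 0), (v, 1), …` to appear in this order, so the second coordinate counts
earlier occurrences. This is what identifies `occ` with positions of pairs. -/
theorem count_val (h : IsMonoidEnum E) (v j : ℕ) :
    ((seg E 0 (E.symm (v, j))).map val).count (v + 1) = j := by
  have : ((seg E 0 (E.symm (v, j))).filter fun p => p.1 = v) =
      (List.range j).map fun i => (v, i) := by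
    refine eq_of_sorted E.symm ((sorted_seg E _ _).filter _) ?_ fun p => ?_
    · rw [List.pairwise_map]
      exact List.pairwise_lt_range.imp fun hab => h.lt_of_lt le_rfl hab.le (Or.inr hab)
    · obtain ⟨a, b⟩ := p
      simp only [List.mem_filter, mem_seg, decide_eq_true_eq, List.mem_map, List.mem_range,
        Prod.mk.injEq]
      constructor
      · rintro ⟨⟨-, hlt⟩, rfl⟩
        refine ⟨b, ?_, rfl, rfl⟩
        by_contra hb
        exact absurd (h.le_of_le le_rfl (not_lt.1 hb)) (not_le.2 hlt)
      · rintro ⟨i, hi, rfl, rfl⟩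
        exact ⟨⟨Nat.zero_le _, h.lt_of_lt le_rfl hi.le (Or.inr hi)⟩, rfl⟩
  have h2 := congrArg List.length this
  rw [List.length_map, List.length_range, ← List.countP_eq_length_filter] at h2
  rw [List.count, List.countP_map]
  refine Eq.trans (List.countP_congr fun p _ => ?_) h2
  simp [val]

theorem occ_eq (h : IsMonoidEnum E) {M v j : ℕ} (hM : E.symm (v, j) < M) :
    occ ((seg E 0 M).map val) (j + 1) (v + 1) = E.symm (v, j) := by
  refine idxOfNth_eq ?_ ?_
  · rw [List.getElem?_map, seg, List.getElem?_map, List.getElem?_range' (by omega)]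
    simp [val]
  · rw [← List.map_take, take_seg _ _ _ _ (by omega), Nat.zero_add, h.count_val,
      Nat.add_sub_cancel]

end IsMonoidEnum

/-! ### One step of the procedure -/

/-- `E` starts with `(0, 0), …, (N + 1, 0), (0, 1)`. -/
structure IsTypeOneEnum (E : ℕ ≃ ℕ × ℕ) (N : ℕ) : Prop extends IsMonoidEnum E where
  low : E.symm (N + 1, 0) < E.symm (0, 1)
  high : E.symm (0, 1) < E.symm (N + 2, 0)

/-- The values enumerated by `E` up to the pair `p`. -/
def initialValues (E : ℕ ≃ ℕ × ℕ) (p : ℕ × ℕ) : List ℕ := (seg E 0 (E.symm p + 1)).map val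

/-- `l` is the least first coordinate that is not enumerated up to `(N + 1, K + 1)`. -/
structure IsNewValue (E : ℕ ≃ ℕ × ℕ) (N K l : ℕ) : Prop where
  lt : E.symm (N + 1, K + 1) < E.symm (l, 0)
  of_lt : ∀ u < l, E.symm (u, 0) < E.symm (N + 1, K + 1)

/-! ### The window between `(N + 1, K + 1)` and `(N + 2, K + 1)`. -/

namespace IsTypeOneEnum

variable {E : ℕ ≃ ℕ × ℕ} {N K l : ℕ}

theorem exists_new (h : IsTypeOneEnum E N) (K : ℕ) :
    ∃ l, IsNewValue E N K l ∧ ell (initialValues E (N + 1, K + 1)) = l + 1 := by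
  have hex := exists_lt_symm E (N + 1, K + 1)
  classical
  have hlt : ∀ u < Nat.find hex, E.symm (u, 0) < E.symm (N + 1, K + 1) := fun u hu => by
    refine lt_of_le_of_ne (not_lt.1 (Nat.find_min hex hu)) fun he => ?_
    have := Prod.mk.inj (E.symm.injective he)
    omega
  refine ⟨Nat.find hex, ⟨Nat.find_spec hex, hlt⟩, ell_map_val _ _ (fun u hu => ?_) ?_⟩
  · exact ⟨(u, 0), mem_seg.2 ⟨Nat.zero_le _, Nat.lt_succ_of_lt (hlt u hu)⟩, rfl⟩
  · rintro ⟨a, b⟩ hp rfl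
    have h1 := (mem_seg.1 hp).2
    have h2 := h.le_of_le (le_refl (Nat.find hex)) (Nat.zero_le b)
    have h3 := Nat.find_spec hex
    omega

theorem new_pos (h : IsTypeOneEnum E N) (hl : IsNewValue E N K l) : 0 < l := by
  rcases Nat.eq_zero_or_pos l with rfl | hl0
  · have := hl.lt
    rw [h.symm_zero] at this
    omega
  · exact hl0

theorem one_lt (h : IsTypeOneEnum E N) : E.symm (1, 0) < E.symm (0, 1) :=
  (h.le_of_le (Nat.succ_le_succ (Nat.zero_le N)) le_rfl).trans_lt h.low

theorem new_lt (h : IsTypeOneEnum E N) (hl : IsNewValue E N K l) :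
    E.symm (l, 0) < E.symm (N + 2, K + 1) := by
  have h0 := h.new_pos hl
  exact h.transfer (hl.of_lt (l - 1) (by omega)) _ _ _ _ (by omega) rfl

theorem lt_one (h : IsTypeOneEnum E N) (K : ℕ) : E.symm (N + 1, K + 1) < E.symm (0, K + 2) :=
  h.transfer h.low _ _ _ _ (by omega) (by omega)

theorem one_lt_high (h : IsTypeOneEnum E N) (K : ℕ) : E.symm (0, K + 2) < E.symm (N + 2, K + 1) :=
  h.transfer h.high _ _ _ _ (by omega) (by omega)

/-- The only new pair with first coordinate `0` between `(N + 1, K + 1)` and `(N + 2, K + 1)`. -/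
theorem snd_eq_of_between (h : IsTypeOneEnum E N) {j : ℕ}
    (h1 : E.symm (N + 1, K + 1) < E.symm (0, j)) (h2 : E.symm (0, j) < E.symm (N + 2, K + 1)) :
    j = K + 2 := by
  rcases lt_trichotomy j (K + 2) with hj | hj | hj
  · have := h.le_of_le (Nat.zero_le (N + 1)) (show j ≤ K + 1 by omega)
    omega
  · exact hj
  -- Here `(N + 2, K + 1) < (N + 1, K + 2) < (0, K + 3) ≤ (0, j)`, which puts `(0, j)` beyond the
  -- window.
  · have e1 := h.le_of_le (le_refl 0) (show K + 3 ≤ j by omega)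
    have e2 := h.transfer h.low (N + 1) (K + 2) 0 (K + 3) (by omega) (by omega)
    have e3 := h.transfer h.one_lt (N + 1) (K + 1) N (K + 2) (by omega) (by omega)
    have e4 := h.transfer h.one_lt (N + 2) (K + 1) (N + 1) (K + 2) (by omega) (by omega)
    omega

/-- The only pair with first coordinate `l` between `(N + 1, K + 1)` and `(N + 2, K + 1)`. -/
theorem snd_eq_zero_of_between (h : IsTypeOneEnum E N) (hl : IsNewValue E N K l) {j : ℕ}
    (h2 : E.symm (l, j) < E.symm (N + 2, K + 1)) : j = 0 := by
  by_contra hj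
  have e1 := h.le_of_le (le_refl l) (show 1 ≤ j by omega)
  have e2 := h.transfer h.one_lt (N + 2) K (N + 1) (K + 1) (by omega) (by omega)
  -- Lowering the second coordinates by one would place `(l, 0)` before `(N + 2, K)`, hence before
  -- `(N + 1, K + 1)`, so `l` would not be new.
  have e3 := h.transfer (e1.trans_lt h2) l 0 (N + 2) K (by omega) (by omega)
  have := hl.lt
  omega

/-- The only pair with second coordinate `0` between `(N + 1, K + 1)` and `(N + 2, K + 1)`. -/
theorem fst_eq_of_between (h : IsTypeOneEnum E N) (hl : IsNewValue E N K l) {v : ℕ}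
    (h1 : E.symm (N + 1, K + 1) < E.symm (v, 0)) (h2 : E.symm (v, 0) < E.symm (N + 2, K + 1)) :
    v = l := by
  rcases lt_trichotomy v l with hv | hv | hv
  · have := hl.of_lt v hv
    omega
  · exact hv
  · have e1 := h.le_of_le (show l + 1 ≤ v by omega) (le_refl 0)
    have e2 := h.transfer (e1.trans_lt h2) l 0 (N + 1) (K + 1) (by omega) (by omega)
    have := hl.lt
    omega

theorem seqT_eq (h : IsTypeOneEnum E N) :
    seqT (N + 2) (K + 2) (initialValues E (N + 1, K + 1)) =
      (((seg E (E.symm (N, K + 1) + 1) (E.symm (N + 1, K + 1))).map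
        fun p => (p.1 + 1, p.2)).map val) := by
  have h1 : E.symm (N, K + 1) < E.symm (N + 1, K + 1) :=
    h.lt_of_lt (Nat.le_succ N) le_rfl (Or.inl (Nat.lt_succ_self N))
  rw [seqT, initialValues, show N + 2 - 1 = N + 1 from rfl, show K + 2 = K + 1 + 1 from rfl,
    h.occ_eq (show E.symm (N, K + 1) < _ by omega),
    h.occ_eq (show E.symm (N + 1, K + 1) < _ by omega), between, ← List.map_take,
    ← List.map_drop, take_seg _ _ _ _ (by omega), Nat.zero_add, drop_seg, map_val_succ]

theorem seqT'_eq (h : IsTypeOneEnum E N) :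
    seqT' (N + 2) (K + 2) (initialValues E (N + 1, K + 1)) =
      (((seg E (E.symm (N + 1, K) + 1) (E.symm (N + 2, K))).map
        fun p => (p.1, p.2 + 1)).map val) := by
  have h2 := h.transfer h.one_lt (N + 2) K (N + 1) (K + 1) (by omega) (by omega)
  have h1 : E.symm (N + 1, K) < E.symm (N + 2, K) :=
    h.lt_of_lt (Nat.le_succ (N + 1)) le_rfl (Or.inl (Nat.lt_succ_self (N + 1)))
  rw [seqT', initialValues, show K + 2 - 1 = K + 1 from rfl,
    h.occ_eq (show E.symm (N + 1, K) < _ by omega),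
    h.occ_eq (show E.symm (N + 2, K) < _ by omega), between, ← List.map_take,
    ← List.map_drop, take_seg _ _ _ _ (by omega), Nat.zero_add, drop_seg, map_val_snd]

theorem sorted_map_fst (h : IsMonoidEnum E) (a b r : ℕ) :
    ((seg E a b).map fun p => (p.1 + r, p.2)).Pairwise (fun p q => E.symm p < E.symm q) := by
  rw [List.pairwise_map]
  exact (sorted_seg E a b).imp fun {p q} hpq => h.add_lt (a := p.1) (c := q.1) hpq r 0

theorem sorted_map_snd (h : IsMonoidEnum E) (a b : ℕ) :
    ((seg E a b).map fun p => (p.1, p.2 + 1)).Pairwise (fun p q => E.symm p < E.symm q) := by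
  rw [List.pairwise_map]
  exact (sorted_seg E a b).imp fun {p q} hpq => h.snd p q hpq

/-- Within the window, `t` consists of the pairs with positive first coordinate and `t'` of those
with positive second coordinate. Both reduce to the same list `C` once `(l, 0)` and `(0, K + 2)` are
erased, so the places of `ℓ` and `1` count the members of `C` before them. A member of `C` between
the two makes these counts differ; hence `o` need only agree with the order when no such member
exists. -/
theorem merge_eq (h : IsTypeOneEnum E N) (hl : IsNewValue E N K l) (o : Bool)
    (ho : (∀ a b, ¬(E.symm (0, K + 2) < E.symm (a + 1, b + 1) ∧
        E.symm (a + 1, b + 1) < E.symm (l, 0)) ∧ ¬(E.symm (l, 0) < E.symm (a + 1, b + 1) ∧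
        E.symm (a + 1, b + 1) < E.symm (0, K + 2))) →
      (o = true ↔ E.symm (0, K + 2) < E.symm (l, 0))) :
    merge o (l + 1) (seqT (N + 2) (K + 2) (initialValues E (N + 1, K + 1)))
        (seqT' (N + 2) (K + 2) (initialValues E (N + 1, K + 1))) =
      (seg E (E.symm (N + 1, K + 1) + 1) (E.symm (N + 2, K + 1))).map val := by
  have hl0 := h.new_pos hl
  have hl1 := hl.lt
  have hl2 := h.new_lt hl
  have ho1 := h.lt_one K
  have ho2 := h.one_lt_high K
  rw [h.seqT_eq, h.seqT'_eq]
  set T := (seg E (E.symm (N, K + 1) + 1) (E.symm (N + 1, K + 1))).map fun p => (p.1 + 1, p.2)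
    with hT
  set T' := (seg E (E.symm (N + 1, K) + 1) (E.symm (N + 2, K))).map fun p => (p.1, p.2 + 1)
    with hT'
  set C := (seg E (E.symm (N + 1, K + 1) + 1) (E.symm (N + 2, K + 1))).filter
    (fun p => 1 ≤ p.1 ∧ 1 ≤ p.2) with hC
  have mT : ∀ p, p ∈ T ↔ 1 ≤ p.1 ∧ E.symm (N + 1, K + 1) < E.symm p ∧
      E.symm p < E.symm (N + 2, K + 1) := by
    rintro ⟨a, b⟩
    simp only [hT, List.mem_map, mem_seg, Prod.exists, Prod.mk.injEq]
    constructor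
    · rintro ⟨a, b, ⟨h1, h2⟩, rfl, rfl⟩
      exact ⟨by omega, h.transfer (Nat.lt_of_succ_le h1) _ _ _ _ (by omega) (by omega),
        h.transfer h2 _ _ _ _ (by omega) (by omega)⟩
    · rintro ⟨h0, h1, h2⟩
      exact ⟨a - 1, b, ⟨Nat.succ_le_of_lt (h.transfer h1 _ _ _ _ (by omega) (by omega)),
        h.transfer h2 _ _ _ _ (by omega) (by omega)⟩, by omega, rfl⟩
  have mT' : ∀ p, p ∈ T' ↔ 1 ≤ p.2 ∧ E.symm (N + 1, K + 1) < E.symm p ∧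
      E.symm p < E.symm (N + 2, K + 1) := by
    rintro ⟨a, b⟩
    simp only [hT', List.mem_map, mem_seg, Prod.exists, Prod.mk.injEq]
    constructor
    · rintro ⟨a, b, ⟨h1, h2⟩, rfl, rfl⟩
      exact ⟨by omega, h.transfer (Nat.lt_of_succ_le h1) _ _ _ _ (by omega) (by omega),
        h.transfer h2 _ _ _ _ (by omega) (by omega)⟩
    · rintro ⟨h0, h1, h2⟩
      exact ⟨a, b - 1, ⟨Nat.succ_le_of_lt (h.transfer h1 _ _ _ _ (by omega) (by omega)),
        h.transfer h2 _ _ _ _ (by omega) (by omega)⟩, rfl, by omega⟩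
  have mC : ∀ p, p ∈ C ↔ (1 ≤ p.1 ∧ 1 ≤ p.2) ∧ E.symm (N + 1, K + 1) < E.symm p ∧
      E.symm p < E.symm (N + 2, K + 1) := by
    intro p
    rw [hC, List.mem_filter, mem_seg, decide_eq_true_eq]
    omega
  have sT : T.Pairwise (fun p q => E.symm p < E.symm q) := sorted_map_fst h.toIsMonoidEnum _ _ 1
  have sT' : T'.Pairwise (fun p q => E.symm p < E.symm q) := sorted_map_snd h.toIsMonoidEnum _ _
  have sC : C.Pairwise (fun p q => E.symm p < E.symm q) := (sorted_seg E _ _).filter _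
  have xT : (l, 0) ∈ T := (mT _).2 ⟨hl0, hl1, hl2⟩
  have xT' : (0, K + 2) ∈ T' := (mT' _).2 ⟨by simp, ho1, ho2⟩
  have uT : ∀ p ∈ T, val p = val (l, 0) → p = (l, 0) := by
    rintro ⟨a, b⟩ hp hv
    obtain rfl : a = l := by simpa [val] using hv
    rw [h.snd_eq_zero_of_between hl ((mT _).1 hp).2.2]
  have uT' : ∀ p ∈ T', val p = val (0, K + 2) → p = (0, K + 2) := by
    rintro ⟨a, b⟩ hp hv
    obtain rfl : a = 0 := by simpa [val] using hv
    rw [h.snd_eq_of_between ((mT' _).1 hp).2.1 ((mT' _).1 hp).2.2]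
  have eT : T.erase (l, 0) = C := by
    rw [erase_eq_filter_of_sorted _ _ sT]
    refine eq_of_sorted E.symm (sT.filter _) sC ?_
    rintro ⟨a, b⟩
    rw [List.mem_filter, mT, mC, bne_iff_ne]
    constructor
    · rintro ⟨⟨h1, h2, h3⟩, h4⟩
      refine ⟨⟨h1, ?_⟩, h2, h3⟩
      by_contra hb
      obtain rfl : b = 0 := by simpa using hb
      exact h4 (by rw [h.fst_eq_of_between hl h2 h3])
    · rintro ⟨⟨h1, h2⟩, h3, h4⟩
      exact ⟨⟨h1, h3, h4⟩, fun he => by simp [(Prod.mk.inj he).2] at h2⟩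
  have eT' : T'.erase (0, K + 2) = C := by
    rw [erase_eq_filter_of_sorted _ _ sT']
    refine eq_of_sorted E.symm (sT'.filter _) sC ?_
    rintro ⟨a, b⟩
    rw [List.mem_filter, mT', mC, bne_iff_ne]
    constructor
    · rintro ⟨⟨h1, h2, h3⟩, h4⟩
      refine ⟨⟨?_, h1⟩, h2, h3⟩
      by_contra hb
      obtain rfl : a = 0 := by simpa using hb
      exact h4 (by rw [h.snd_eq_of_between h2 h3])
    · rintro ⟨⟨h1, h2⟩, h3, h4⟩
      exact ⟨⟨h2, h3, h4⟩, fun he => by simp [(Prod.mk.inj he).1] at h1⟩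
  have xy : E.symm (0, K + 2) ≠ E.symm (l, 0) := fun he => by
    simpa using E.symm.injective he
  have i1 : (T.map val).idxOf (val (l, 0)) = C.countP fun a => E.symm a < E.symm (l, 0) := by
    rw [idxOf_map_of_unique val _ _ uT, idxOf_eq_countP E.symm _ _ sT xT, ← eT,
      (List.perm_cons_erase xT).countP_eq, List.countP_cons_of_neg (by simp)]
  have i2 : (T'.map val).idxOf 1 = C.countP fun a => E.symm a < E.symm (0, K + 2) := by
    rw [show 1 = val (0, K + 2) from rfl, idxOf_map_of_unique val _ _ uT',
      idxOf_eq_countP E.symm _ _ sT' xT', ← eT',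
      (List.perm_cons_erase xT').countP_eq, List.countP_cons_of_neg (by simp)]
  have key : ∀ x y c : ℕ × ℕ, c ∈ C → E.symm x < E.symm c → E.symm c < E.symm y →
      (C.countP fun a => E.symm a < E.symm x) < C.countP fun a => E.symm a < E.symm y := by
    intro x y c hc h1 h2
    rw [List.countP_eq_length_filter, List.countP_eq_length_filter]
    have hp : (C.filter fun a => E.symm a < E.symm x) <+:
        (C.filter fun a => E.symm a < E.symm y) := by
      refine ⟨C.filter fun a => E.symm x ≤ E.symm a ∧ E.symm a < E.symm y, ?_⟩
      refine eq_of_sorted E.symm ?_ (sC.filter _) fun a => ?_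
      · rw [List.pairwise_append]
        refine ⟨sC.filter _, sC.filter _, fun a ha b hb => ?_⟩
        simp only [List.mem_filter, decide_eq_true_eq] at ha hb
        omega
      · simp only [List.mem_append, List.mem_filter, decide_eq_true_eq, ← and_or_left]
        refine and_congr_right fun _ => ?_
        omega
    refine lt_of_le_of_ne hp.length_le fun he => ?_
    have hm : c ∈ C.filter fun a => E.symm a < E.symm y := by simp [hc, h2]
    rw [← hp.eq_of_length he] at hm
    simp only [List.mem_filter, decide_eq_true_eq] at hm
    omega
  obtain ⟨L, sL, mL, hL⟩ := exists_sorted_merge E.symm val (0, K + 2) (l, 0) C o (T.map val)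
    (T'.map val) sC
    (fun a ha he => by have := ((mC _).1 ha).1.1; simp [E.symm.injective he] at this)
    (fun a ha he => by have := ((mC _).1 ha).1.2; simp [E.symm.injective he] at this) xy rfl
    (by rw [show 1 = val (0, K + 2) from rfl, erase_map_of_unique val _ _ uT', eT']) i1 i2
    (fun he => ho fun a b => by
      rw [i1, i2] at he
      constructor
      · rintro ⟨h1, h2⟩
        have := key (0, K + 2) (l, 0) (a + 1, b + 1) ((mC _).2 ⟨by simp, by omega, by omega⟩) h1 h2
        omega
      · rintro ⟨h1, h2⟩
        have := key (l, 0) (0, K + 2) (a + 1, b + 1) ((mC _).2 ⟨by simp, by omega, by omega⟩) h1 h2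
        omega)
  rw [show l + 1 = val (l, 0) from rfl, hL]
  congr 1
  refine eq_of_sorted E.symm sL (sorted_seg E _ _) ?_
  rintro ⟨a, b⟩
  rw [mL, mC, mem_seg]
  constructor
  · rintro (he | he | he)
    · rw [he]; omega
    · rw [he]; omega
    · omega
  · rintro ⟨h1, h2⟩
    rcases Nat.eq_zero_or_pos a with rfl | ha
    · rw [h.snd_eq_of_between h1 h2]; exact Or.inl rfl
    rcases Nat.eq_zero_or_pos b with rfl | hb
    · rw [h.fst_eq_of_between hl h1 h2]; exact Or.inr (Or.inl rfl)
    · exact Or.inr (Or.inr ⟨⟨ha, hb⟩, h1, h2⟩)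

end IsTypeOneEnum

/-- The pairs from `(0, K + 2)` to `(N + 1, K + 2)`, without the pairs `(v, 0)` with `v ≥ c`. -/
def partialBlock (E : ℕ ≃ ℕ × ℕ) (N K c : ℕ) : List (ℕ × ℕ) :=
  (seg E (E.symm (0, K + 2)) (E.symm (N + 1, K + 2) + 1)).filter fun p => 1 ≤ p.2 ∨ p.1 < c

theorem mem_partialBlock {E : ℕ ≃ ℕ × ℕ} {N K c : ℕ} {p : ℕ × ℕ} :
    p ∈ partialBlock E N K c ↔ (E.symm (0, K + 2) ≤ E.symm p ∧
      E.symm p ≤ E.symm (N + 1, K + 2)) ∧ (1 ≤ p.2 ∨ p.1 < c) := by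
  rw [partialBlock, List.mem_filter, mem_seg, decide_eq_true_eq, Nat.lt_succ_iff]

theorem sorted_partialBlock (E : ℕ ≃ ℕ × ℕ) (N K c : ℕ) :
    (partialBlock E N K c).Pairwise (fun p q => E.symm p < E.symm q) :=
  (sorted_seg E _ _).filter _

/-! ### Rewriting the last block and inserting the new values. -/

namespace IsTypeOneEnum

variable {E : ℕ ≃ ℕ × ℕ} {N K l m : ℕ}

theorem block_eq (h : IsTypeOneEnum E N) (hl : IsNewValue E N K l) :
    block (N + 2) (K + 2) (initialValues E (N + 1, K + 1)) =
      (partialBlock E N K l).map val := by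
  have h1 : E.symm (0, K + 1) < E.symm (N + 1, K + 1) :=
    h.lt_of_lt (Nat.zero_le _) le_rfl (Or.inl (Nat.succ_pos N))
  have h2 := h.lt_one K
  have h3 := hl.lt
  rw [block, initialValues, show K + 2 = K + 1 + 1 from rfl,
    h.occ_eq (show E.symm (0, K + 1) < _ by omega),
    h.occ_eq (show E.symm (N + 1, K + 1) < _ by omega), ← List.map_take,
    ← List.map_drop, take_seg _ _ _ _ (by omega), Nat.zero_add, drop_seg, map_val_snd]
  congr 1
  refine eq_of_sorted E.symm (sorted_map_snd h.toIsMonoidEnum _ _) (sorted_partialBlock _ _ _ _) ?_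
  rintro ⟨a, b⟩
  rw [mem_partialBlock]
  simp only [List.mem_map, mem_seg, Prod.exists, Prod.mk.injEq, Nat.lt_succ_iff]
  have tr : ∀ a b c d, E.symm (a, b) ≤ E.symm (c, d) ↔ E.symm (a, b + 1) ≤ E.symm (c, d + 1) := by
    intro a b c d
    rw [← not_lt, ← not_lt, not_iff_not]
    exact ⟨fun hlt => h.snd _ _ hlt, fun hlt => h.transfer hlt _ _ _ _ (by omega) (by omega)⟩
  constructor
  · rintro ⟨a, b, ⟨h4, h5⟩, rfl, rfl⟩
    exact ⟨⟨(tr _ _ _ _).1 h4, (tr _ _ _ _).1 h5⟩, Or.inl (by simp)⟩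
  · rintro ⟨⟨h4, h5⟩, h6⟩
    -- A pair with second coordinate `0` and value below `l` was already enumerated before this
    -- block.
    rcases Nat.eq_zero_or_pos b with rfl | hb
    · have := hl.of_lt a (by simpa using h6)
      omega
    · obtain ⟨b, rfl⟩ : ∃ c, b = c + 1 := ⟨b - 1, by omega⟩
      exact ⟨a, b, ⟨(tr _ _ _ _).2 h4, (tr _ _ _ _).2 h5⟩, rfl, rfl⟩

/-- The main terms occur once in a block. -/
theorem snd_eq_of_mem_partialBlock (h : IsTypeOneEnum E N) (hm : m ≤ N + 1) {c j : ℕ}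
    (hp : (m, j) ∈ partialBlock E N K c) : j = K + 2 := by
  obtain ⟨⟨h1, h2⟩, -⟩ := mem_partialBlock.1 hp
  rcases lt_trichotomy j (K + 2) with hj | hj | hj
  · have := h.le_of_le hm (show j ≤ K + 1 by omega)
    have := h.lt_one K
    omega
  · exact hj
  · have := h.le_of_le (Nat.zero_le m) (show K + 3 ≤ j by omega)
    have : E.symm (N + 1, K + 2) < E.symm (0, K + 3) := h.lt_one (K + 1)
    omega

theorem main_mem (h : IsTypeOneEnum E N) (hm : m ≤ N + 1) (c : ℕ) :
    (m, K + 2) ∈ partialBlock E N K c :=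
  mem_partialBlock.2 ⟨⟨h.le_of_le (Nat.zero_le m) le_rfl, h.le_of_le hm le_rfl⟩, Or.inl (by simp)⟩

theorem idxOf_main (h : IsTypeOneEnum E N) (hm : m ≤ N + 1) (c : ℕ) :
    ((partialBlock E N K c).map val).idxOf (1 + m) =
      (partialBlock E N K c).countP fun p => E.symm p < E.symm (m, K + 2) := by
  rw [show 1 + m = val (m, K + 2) from add_comm 1 m, idxOf_map_of_unique,
    idxOf_eq_countP E.symm _ _ (sorted_partialBlock _ _ _ _) (h.main_mem hm c)]
  rintro ⟨a, b⟩ hp hv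
  obtain rfl : a = m := by simpa [val] using hv
  rw [h.snd_eq_of_mem_partialBlock hm hp]

/-- The new term that belongs to the main term `m`, if it lies in the block, is the least positive
integer that does not appear. -/
theorem ell_partialBlock (h : IsTypeOneEnum E N)
    (h1 : E.symm (0, K + 2) < E.symm (l + m, 0)) (h2 : E.symm (l + m, 0) < E.symm (N + 1, K + 2)) :
    ell ((seg E 0 (E.symm (0, K + 2))).map val ++ (partialBlock E N K (l + m)).map val) =
      l + m + 1 := by
  rw [← List.map_append]
  refine ell_map_val _ _ (fun u hu => ⟨(u, 0), ?_, rfl⟩) ?_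
  · have := h.lt_of_lt hu.le (le_refl 0) (Or.inl hu)
    rw [List.mem_append, mem_seg, mem_partialBlock]
    dsimp only
    omega
  · rintro ⟨a, b⟩ hp rfl
    have e1 := h.le_of_le le_rfl (Nat.zero_le b) (a := l + m)
    rw [List.mem_append, mem_seg, mem_partialBlock] at hp
    rcases hp with hp | ⟨⟨h3, h4⟩, h5⟩
    · omega
    · have e2 := h.le_of_le le_rfl (show 1 ≤ b by simpa using h5) (a := l + m)
      have e3 : E.symm (l + m, 0) ≤ E.symm (N + 1, K + 1) := by
        by_contra hn
        have := h.transfer (not_le.1 hn) (N + 1) (K + 2) (l + m) 1 (by omega) (by omega)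
        omega
      have := h.lt_one K
      omega

/-- Counting the terms between a main term and the new term that belongs to it. -/
theorem countP_partialBlock (h : IsTypeOneEnum E N) {x y x' y' : ℕ × ℕ} {c r : ℕ}
    (hx : x' = (x.1 + m, x.2)) (hy : y' = (y.1 + m, y.2))
    (hxy : E.symm x' < E.symm y')
    (hr : r = 0 ∨ r = 1)
    (hmem : ∀ a b, E.symm x' + r ≤ E.symm (a, b) → E.symm (a, b) < E.symm y' →
      m ≤ a ∧ (a, b) ∈ partialBlock E N K c)
    (hle : r = 1 → x' ∉ partialBlock E N K c) :
    (partialBlock E N K c).countP (fun p => E.symm p < E.symm y') =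
      (partialBlock E N K c).countP (fun p => E.symm p < E.symm x') +
        (E.symm y - (E.symm x + r)) := by
  subst hx hy
  have hlen : E.symm y - (E.symm x + r) = ((seg E (E.symm x + r) (E.symm y)).map
      (fun p : ℕ × ℕ => (p.1 + m, p.2))).length := by rw [List.length_map, length_seg]
  rw [List.countP_eq_length_filter, List.countP_eq_length_filter, hlen, ← List.length_append]
  congr 1
  -- The terms from `x'` to `y'` are the translates by `(m, 0)` of those from `x` to `y`, apart from
  -- pairs with first coordinate below `m`, which `hmem` excludes. The offset `r = 1` omits `x'`
  -- itself when it is the new term not yet inserted.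
  have key : ∀ a b, (a, b) ∈ (seg E (E.symm x + r) (E.symm y)).map
      (fun p : ℕ × ℕ => (p.1 + m, p.2)) ↔
      m ≤ a ∧ E.symm (x.1 + m, x.2) + r ≤ E.symm (a, b) ∧ E.symm (a, b) < E.symm (y.1 + m, y.2) := by
    have tr : ∀ p q : ℕ × ℕ, E.symm p < E.symm q ↔
        E.symm (p.1 + m, p.2) < E.symm (q.1 + m, q.2) := fun p q =>
      ⟨fun hlt => h.transfer (a := p.1) (b := p.2) (c := q.1) (d := q.2) hlt _ _ _ _
        (by omega) (by omega),
      fun hlt => h.transfer hlt p.1 p.2 q.1 q.2 (by omega) (by omega)⟩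
    have tr' : ∀ p : ℕ × ℕ, E.symm x + r ≤ E.symm p ↔
        E.symm (x.1 + m, x.2) + r ≤ E.symm (p.1 + m, p.2) := by
      intro p
      rcases hr with rfl | rfl
      · rw [add_zero, add_zero, ← not_lt, ← not_lt, not_iff_not]
        exact tr p x
      · exact tr x p
    intro a b
    simp only [List.mem_map, mem_seg, Prod.exists, Prod.mk.injEq]
    constructor
    · rintro ⟨a, b, ⟨h4, h5⟩, rfl, rfl⟩
      exact ⟨by omega, (tr' (a, b)).1 h4, (tr (a, b) y).1 h5⟩
    · rintro ⟨h4, h5, h6⟩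
      obtain ⟨a, rfl⟩ := Nat.exists_eq_add_of_le' h4
      exact ⟨a, b, ⟨(tr' (a, b)).2 h5, (tr (a, b) y).2 h6⟩, rfl, rfl⟩
  refine eq_of_sorted E.symm ((sorted_partialBlock _ _ _ _).filter _) ?_ ?_
  · rw [List.pairwise_append]
    refine ⟨(sorted_partialBlock _ _ _ _).filter _, sorted_map_fst h.toIsMonoidEnum _ _ m, ?_⟩
    rintro ⟨a, b⟩ ha ⟨a', b'⟩ hb
    rw [key] at hb
    rw [List.mem_filter, decide_eq_true_eq] at ha
    omega
  · rintro ⟨a, b⟩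
    rw [List.mem_append, key, List.mem_filter, List.mem_filter, decide_eq_true_eq,
      decide_eq_true_eq]
    constructor
    · rintro ⟨h4, h5⟩
      by_cases h6 : E.symm (a, b) < E.symm (x.1 + m, x.2)
      · exact Or.inl ⟨h4, h6⟩
      · right
        have h7 : E.symm (x.1 + m, x.2) + r ≤ E.symm (a, b) := by
          rcases hr with rfl | rfl
          · omega
          · refine Nat.succ_le_of_lt (lt_of_le_of_ne (not_lt.1 h6) fun he => ?_)
            exact hle rfl (by rw [E.symm.injective he]; exact h4)
        exact ⟨(hmem a b h7 h5).1, h7, h5⟩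
    · rintro (⟨h4, h5⟩ | ⟨h4, h5, h6⟩)
      · exact ⟨h4, by omega⟩
      · exact ⟨(hmem a b h5 h6).2, h6⟩

/-- Hypothesis `hq` says that the prescribed place is the number of terms already written that
precede `(l + m, 0)`, so the insertion keeps the block sorted. -/
theorem insertNew_of_mem (h : IsTypeOneEnum E N)
    (h1 : E.symm (0, K + 2) < E.symm (l + m, 0)) (h2 : E.symm (l + m, 0) < E.symm (N + 1, K + 2))
    (d : ℤ) (hq : (if 0 < d then
        ((((partialBlock E N K (l + m)).map val).idxOf (1 + m) : ℕ) : ℤ) + 1 - d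
      else ((((partialBlock E N K (l + m)).map val).idxOf (1 + m) : ℕ) : ℤ) - d) =
        (((partialBlock E N K (l + m)).countP fun p => E.symm p < E.symm (l + m, 0) : ℕ) : ℤ)) :
    insertNew d ((seg E 0 (E.symm (0, K + 2))).map val) ((partialBlock E N K (l + m)).map val)
      (1 + m) = (partialBlock E N K (l + m + 1)).map val := by
  have hpos : 0 < (partialBlock E N K (l + m)).countP fun p => E.symm p < E.symm (l + m, 0) :=
    List.countP_pos_iff.2 ⟨_, h.main_mem (Nat.zero_le _) _, by simpa using h1⟩
  have hlt : ((partialBlock E N K (l + m)).countP fun p => E.symm p < E.symm (l + m, 0)) <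
      (partialBlock E N K (l + m)).length := by
    refine lt_of_le_of_ne List.countP_le_length fun he => ?_
    have := List.countP_eq_length.1 he _ (h.main_mem le_rfl _)
    rw [decide_eq_true_eq] at this
    omega
  simp only [insertNew]
  rw [hq, if_pos ⟨by omega, by rw [List.length_map]; omega⟩, Int.toNat_natCast,
    h.ell_partialBlock h1 h2, show l + m + 1 = val (l + m, 0) from rfl, ← map_insertIdx']
  congr 1
  refine eq_of_sorted E.symm (pairwise_insertIdx_countP E.symm _ _ (sorted_partialBlock _ _ _ _)
    ?_) (sorted_partialBlock _ _ _ _) ?_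
  · intro p hp he
    rw [E.symm.injective he, mem_partialBlock] at hp
    simp at hp
  · rintro ⟨a, b⟩
    rw [List.mem_insertIdx hlt.le, mem_partialBlock, mem_partialBlock, Prod.mk.injEq]
    constructor
    · rintro (⟨rfl, rfl⟩ | hp)
      · simp only [val]; omega
      · simp only [val]; omega
    · rintro ⟨h3, h4⟩
      simp only [val] at *
      omega

theorem insertNew_of_notMem (hm : (l + m, 0) ∉ partialBlock E N K (l + m + 1))
    (d : ℤ) (R : List ℕ) (hq : ¬ (1 ≤ (if 0 < d then
        ((((partialBlock E N K (l + m)).map val).idxOf (1 + m) : ℕ) : ℤ) + 1 - d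
      else ((((partialBlock E N K (l + m)).map val).idxOf (1 + m) : ℕ) : ℤ) - d) ∧
      (if 0 < d then
        ((((partialBlock E N K (l + m)).map val).idxOf (1 + m) : ℕ) : ℤ) + 1 - d
      else ((((partialBlock E N K (l + m)).map val).idxOf (1 + m) : ℕ) : ℤ) - d) <
        (((partialBlock E N K (l + m)).length : ℕ) : ℤ))) :
    insertNew d R ((partialBlock E N K (l + m)).map val) (1 + m) =
      (partialBlock E N K (l + m + 1)).map val := by
  simp only [insertNew]
  rw [List.length_map, if_neg hq]
  congr 1
  refine eq_of_sorted E.symm (sorted_partialBlock _ _ _ _) (sorted_partialBlock _ _ _ _) ?_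
  rintro ⟨a, b⟩
  rw [mem_partialBlock] at hm ⊢
  rw [mem_partialBlock]
  refine and_congr_right fun h1 => ⟨fun h2 => by dsimp only at *; omega, fun h2 => ?_⟩
  by_contra h3
  obtain rfl : a = l + m := by dsimp only at *; omega
  obtain rfl : b = 0 := by dsimp only at *; omega
  exact hm ⟨h1, h2⟩

/-- Translation by `(m, 0)` gives `(m, K + 2)` and `(l + m, 0)` the same relative order as `(0, K +
2)` and `(l, 0)`, and the same offset whenever the new term falls in the block. If `d < 0`, the term
falls in the block except for the last main term, where it comes after the final `n`. If `d > 0`,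
the only exception is the first main term, where it precedes the initial `1`. -/
theorem insertNew_eq (h : IsTypeOneEnum E N) (hl : IsNewValue E N K l) (hm : m ≤ N + 1) :
    insertNew ((E.symm (0, K + 2) : ℤ) - (E.symm (l, 0) : ℤ))
      ((seg E 0 (E.symm (0, K + 2))).map val) ((partialBlock E N K (l + m)).map val) (1 + m) =
      (partialBlock E N K (l + m + 1)).map val := by
  have hl1 := hl.lt
  have hl2 := h.new_lt hl
  have e1 := h.lt_one K
  have e2 := h.lt_one (K + 1)
  have xy : E.symm (0, K + 2) ≠ E.symm (l, 0) := fun he => by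
    simpa using E.symm.injective he
  have e3 := h.transfer hl1 (N + 1 + m) (K + 1) (l + m) 0 (by omega) (by omega)
  have e4 := h.transfer hl2 (l + m) 0 (N + 2 + m) (K + 1) (by omega) (by omega)
  have e5 := h.transfer h.high m (K + 2) (N + 2 + m) (K + 1) (by omega) (by omega)
  have e6 := h.transfer h.low (N + 1 + m) (K + 1) m (K + 2) (by omega) (by omega)
  have e7 := h.transfer h.low (N + 1) (K + 2) 0 (K + 3) (by omega) (by omega)
  have e8 := h.le_of_le hm (le_refl (K + 2))
  rcases lt_or_gt_of_ne xy with hlt | hlt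
  · have d0 : ¬ (0 < (E.symm (0, K + 2) : ℤ) - (E.symm (l, 0) : ℤ)) := by omega
    have f1 := h.transfer hlt m (K + 2) (l + m) 0 (by omega) (by omega)
    rcases hm.lt_or_eq with hm' | rfl
    -- In the block: `(m, K + 2) < (l + m, 0) < (N + 2 + m, K + 1) < (m + 1, K + 2) ≤ (N + 1, K +
    -- 2)`.
    · have f2 := h.transfer e4 (l + m) 0 (N + 2 + m) (K + 1) rfl rfl
      have f3 := h.transfer h.low (N + 2 + m) (K + 1) (m + 1) (K + 2) (by omega) (by omega)
      have f4 := h.le_of_le (show m + 1 ≤ N + 1 by omega) (le_refl (K + 2))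
      have f5 := h.le_of_le (Nat.zero_le m) (le_refl (K + 2))
      refine h.insertNew_of_mem (by omega) (by omega) _ ?_
      rw [if_neg d0, h.idxOf_main hm, h.countP_partialBlock (x := (0, K + 2)) (y := (l, 0))
        (x' := (m, K + 2)) (y' := (l + m, 0)) (m := m) (r := 0) (by simp) rfl f1 (Or.inl rfl)
        ?_ (by simp)]
      · omega
      · intro a b h1 h2
        constructor
        · by_contra ha
          have g1 := h.lt_of_lt (show a ≤ m by omega) (le_refl (K + 2)) (Or.inl (by omega))
          have g2 : K + 3 ≤ b := by
            by_contra hb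
            have := h.le_of_le (le_refl a) (show b ≤ K + 2 by omega)
            omega
          have g3 := h.le_of_le (Nat.zero_le a) g2
          omega
        · rw [mem_partialBlock]
          refine ⟨by omega, ?_⟩
          by_contra hn
          obtain rfl : b = 0 := by simp only at hn; omega
          have := h.le_of_le (show l + m ≤ a by simp only at hn; omega) (le_refl 0)
          omega
    · refine insertNew_of_notMem (fun hp => ?_) _ _ ?_
      · have := (mem_partialBlock.1 hp).1.2
        omega
      · rw [if_neg d0, h.idxOf_main hm]
        have hc : (partialBlock E N K (l + (N + 1))).length ≤
            (partialBlock E N K (l + (N + 1))).countP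
              (fun p => E.symm p < E.symm (N + 1, K + 2)) + 1 := by
          have hf : (partialBlock E N K (l + (N + 1))).filter
              (fun p => ¬ E.symm p < E.symm (N + 1, K + 2)) = [(N + 1, K + 2)] := by
            refine eq_of_sorted E.symm ((sorted_partialBlock _ _ _ _).filter _) (by simp) ?_
            intro p
            rw [List.mem_filter, List.mem_singleton, decide_eq_true_eq]
            constructor
            · rintro ⟨hp, hp'⟩
              have := (mem_partialBlock.1 hp).1.2
              exact E.symm.injective (by omega)
            · rintro rfl
              exact ⟨h.main_mem le_rfl _, lt_irrefl _⟩
          have := congrArg List.length hf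
          rw [← List.countP_eq_length_filter] at this
          rw [List.length_eq_countP_add_countP (fun p => E.symm p < E.symm (N + 1, K + 2))]
          simp only [decide_eq_true_eq] at this ⊢
          simp only [List.length_singleton] at this
          omega
        omega
  · have d0 : 0 < (E.symm (0, K + 2) : ℤ) - (E.symm (l, 0) : ℤ) := by omega
    have f1 := h.transfer hlt (l + m) 0 m (K + 2) (by omega) (by omega)
    rcases Nat.eq_zero_or_pos m with rfl | hm0
    · refine insertNew_of_notMem (fun hp => ?_) _ _ ?_
      · have := (mem_partialBlock.1 hp).1.1
        rw [add_zero] at this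
        omega
      · rw [if_pos d0, h.idxOf_main hm]
        have : ((partialBlock E N K (l + 0)).countP
            fun p => E.symm p < E.symm (0, K + 2)) = 0 := by
          rw [List.countP_eq_zero]
          intro p hp
          have := (mem_partialBlock.1 hp).1.1
          rw [decide_eq_true_eq]
          omega
        omega
    -- In the block: `(m - 1, K + 2) < (N + 1 + m, K + 1) < (l + m, 0) < (m, K + 2)`.
    · have f2 := h.transfer h.high (m - 1) (K + 2) (N + 1 + m) (K + 1) (by omega) (by omega)
      have f3 := h.le_of_le (Nat.zero_le (m - 1)) (le_refl (K + 2))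
      refine h.insertNew_of_mem (by omega) (by omega) _ ?_
      rw [if_pos d0, h.idxOf_main hm, h.countP_partialBlock (x := (l, 0)) (y := (0, K + 2))
        (x' := (l + m, 0)) (y' := (m, K + 2)) (m := m) (r := 1) rfl (by simp) f1 (Or.inr rfl)
        ?_ ?_]
      · omega
      · intro a b h1 h2
        constructor
        · by_contra ha
          have g1 := h.le_of_le (show a ≤ m - 1 by omega) (le_refl (K + 2))
          have g2 : K + 3 ≤ b := by
            by_contra hb
            have := h.le_of_le (le_refl a) (show b ≤ K + 2 by omega)
            omega
          have g3 := h.le_of_le (Nat.zero_le a) g2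
          omega
        · rw [mem_partialBlock]
          refine ⟨by omega, ?_⟩
          by_contra hn
          obtain rfl : b = 0 := by simp only at hn; omega
          have g1 := h.le_of_le (show l + m + 1 ≤ a by
            by_contra hh
            obtain rfl : a = l + m := by simp only at hn; omega
            omega) (le_refl 0)
          have g2 := h.transfer hl1 (N + 2 + m) (K + 1) (l + m + 1) 0 (by omega) (by omega)
          omega
      · intro _ hp
        have := (mem_partialBlock.1 hp).2
        simp at this

theorem extend_eq (h : IsTypeOneEnum E N) (hl : IsNewValue E N K l)
    (hell : ell (initialValues E (N + 1, K + 1)) = l + 1) (o : Bool)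
    (ho : (∀ a b, ¬(E.symm (0, K + 2) < E.symm (a + 1, b + 1) ∧
        E.symm (a + 1, b + 1) < E.symm (l, 0)) ∧ ¬(E.symm (l, 0) < E.symm (a + 1, b + 1) ∧
        E.symm (a + 1, b + 1) < E.symm (0, K + 2))) →
      (o = true ↔ E.symm (0, K + 2) < E.symm (l, 0))) :
    extend (N + 2) (K + 2) o (initialValues E (N + 1, K + 1)) =
      initialValues E (N + 1, K + 2) := by
  have hl1 := hl.lt
  have hl2 := h.new_lt hl
  have e1 := h.lt_one K
  have e2 := h.one_lt_high K
  have hi1 : ((seg E (E.symm (N + 1, K + 1) + 1) (E.symm (N + 2, K + 1))).map val).idxOf 1 =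
      E.symm (0, K + 2) - (E.symm (N + 1, K + 1) + 1) := by
    change List.idxOf (val (0, K + 2)) _ = _
    rw [idxOf_map_of_unique, idxOf_seg]
    · rw [mem_seg]; omega
    · rintro ⟨a, b⟩ hp hv
      obtain rfl : a = 0 := by simpa [val] using hv
      rw [mem_seg] at hp
      rw [h.snd_eq_of_between hp.1 hp.2]
  have hil : ((seg E (E.symm (N + 1, K + 1) + 1) (E.symm (N + 2, K + 1))).map val).idxOf (l + 1) =
      E.symm (l, 0) - (E.symm (N + 1, K + 1) + 1) := by
    rw [show l + 1 = val (l, 0) from rfl, idxOf_map_of_unique, idxOf_seg]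
    · rw [mem_seg]; omega
    · rintro ⟨a, b⟩ hp hv
      obtain rfl : a = l := by simpa [val] using hv
      rw [mem_seg] at hp
      rw [h.snd_eq_zero_of_between hl hp.2]
  have hd : shift (l + 1) ((seg E (E.symm (N + 1, K + 1) + 1) (E.symm (N + 2, K + 1))).map val) =
      (E.symm (0, K + 2) : ℤ) - (E.symm (l, 0) : ℤ) := by
    rw [shift, hi1, hil]; omega
  simp only [extend]
  rw [hell, h.merge_eq hl o ho, hd, hi1, h.block_eq hl, ← List.map_take,
    take_seg _ _ _ _ (by omega), Nat.add_sub_cancel' (by omega)]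
  have hR : initialValues E (N + 1, K + 1) ++
      (seg E (E.symm (N + 1, K + 1) + 1) (E.symm (0, K + 2))).map val =
      (seg E 0 (E.symm (0, K + 2))).map val := by
    rw [initialValues, ← List.map_append, seg_append E (Nat.zero_le _) (by omega)]
  rw [hR]
  have hfold : ∀ m ≤ N + 2, (List.range' 1 m).foldl
      (insertNew ((E.symm (0, K + 2) : ℤ) - (E.symm (l, 0) : ℤ))
        ((seg E 0 (E.symm (0, K + 2))).map val)) ((partialBlock E N K l).map val) =
      (partialBlock E N K (l + m)).map val := by
    intro m
    induction m with
    | zero => intro _; rfl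
    | succ m ih =>
      intro hm
      rw [List.range'_1_concat, List.foldl_append, ih (by omega), List.foldl_cons, List.foldl_nil,
        h.insertNew_eq hl (by omega), add_assoc]
  rw [hfold _ le_rfl, ← List.map_append, initialValues]
  have e3 := h.le_of_le (Nat.zero_le (N + 1)) (le_refl (K + 2))
  rw [← seg_append E (Nat.zero_le _) (show E.symm (0, K + 2) ≤ E.symm (N + 1, K + 2) + 1 by omega)]
  congr 2
  refine eq_of_sorted E.symm (sorted_partialBlock _ _ _ _) (sorted_seg _ _ _) ?_
  rintro ⟨a, b⟩
  rw [mem_partialBlock, mem_seg, Nat.lt_succ_iff]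
  refine and_iff_left_of_imp fun hp => ?_
  by_contra hn
  obtain rfl : b = 0 := by simp only at hn; omega
  -- The `N + 2` main terms account for all new values of the block: `(l + N + 2, 0)` already lies
  -- beyond `(N + 1, K + 2)`.
  have g1 := h.le_of_le (show l + (N + 2) ≤ a by simp only at hn; omega) (le_refl 0)
  have g2 := h.transfer hl1 (N + 1 + (N + 2)) (K + 1) (l + (N + 2)) 0 (by omega) (by omega)
  have g3 := h.transfer h.high (N + 1) (K + 2) (N + 1 + (N + 2)) (K + 1) (by omega) (by omega)
  omega

/-- Translating `low` and `high` interlaces the second block: `(m, 1) < (N + 2 + m, 0) < (m + 1,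
1)`. -/
theorem initialValues_one (h : IsTypeOneEnum E N) :
    initialValues E (N + 1, 1) = firstTwoBlocks (N + 2) := by
  have hF : seg E 0 (E.symm (N + 1, 1) + 1) = (List.range (N + 2)).map (fun v => (v, 0)) ++
      (List.range (N + 1)).flatMap (fun m => [(m, 1), (N + 2 + m, 0)]) ++ [(N + 1, 1)] := by
    have t1 : ∀ m, E.symm (m, 1) < E.symm (N + 2 + m, 0) := fun m =>
      h.transfer h.high _ _ _ _ (by omega) (by omega)
    have t2 : ∀ m, E.symm (N + 2 + m, 0) < E.symm (m + 1, 1) := fun m =>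
      h.transfer h.low _ _ _ _ (by omega) (by omega)
    have t3 : ∀ m m', m ≤ m' → E.symm (m, 1) ≤ E.symm (m', 1) := fun m m' hm =>
      h.le_of_le hm le_rfl
    have t4 : ∀ v v', v ≤ v' → E.symm (v, 0) ≤ E.symm (v', 0) := fun m m' hm =>
      h.le_of_le hm le_rfl
    refine eq_of_sorted E.symm (sorted_seg _ _ _) ?_ ?_
    · rw [List.pairwise_append, List.pairwise_append]
      refine ⟨⟨?_, ?_, ?_⟩, by simp, ?_⟩
      · rw [List.pairwise_map]
        exact List.pairwise_lt_range.imp fun hab => h.lt_of_lt hab.le le_rfl (Or.inl hab)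
      · rw [List.pairwise_flatMap]
        refine ⟨fun m _ => by simpa using t1 m, List.pairwise_lt_range.imp fun {m m'} hab => ?_⟩
        intro p hp q hq
        have s1 := t1 m
        have s2 := t2 m
        have s3 := t3 (m + 1) m' hab
        have s4 := t1 m'
        simp only [List.mem_cons, List.not_mem_nil, or_false] at hp hq
        rcases hp with rfl | rfl <;> rcases hq with rfl | rfl <;> omega
      · intro p hp q hq
        obtain ⟨v, hv, rfl⟩ := List.mem_map.1 hp
        obtain ⟨m, hm, hq⟩ := List.mem_flatMap.1 hq
        rw [List.mem_range] at hv
        have s1 := t4 v (N + 1) (by omega)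
        have s2 := h.low
        have s3 := t3 0 m (Nat.zero_le _)
        have s4 := t1 m
        simp only [List.mem_cons, List.not_mem_nil, or_false] at hq
        rcases hq with rfl | rfl <;> omega
      · intro p hp q hq
        rw [List.mem_singleton] at hq
        subst hq
        rcases List.mem_append.1 hp with hp | hp
        · obtain ⟨v, hv, rfl⟩ := List.mem_map.1 hp
          rw [List.mem_range] at hv
          have s1 := t4 v (N + 1) (by omega)
          have s2 := h.low
          have s3 := t3 0 (N + 1) (Nat.zero_le _)
          omega
        · obtain ⟨m, hm, hp⟩ := List.mem_flatMap.1 hp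
          rw [List.mem_range] at hm
          have s1 := t1 m
          have s2 := t2 m
          have s3 := t3 (m + 1) (N + 1) (by omega)
          simp only [List.mem_cons, List.not_mem_nil, or_false] at hp
          rcases hp with rfl | rfl <;> omega
    · rintro ⟨a, b⟩
      simp only [mem_seg, List.mem_append, List.mem_map, List.mem_flatMap, List.mem_range,
        List.mem_cons, List.not_mem_nil, or_false, Prod.mk.injEq, Nat.zero_le, true_and,
        Nat.lt_succ_iff]
      constructor
      · intro hle
        have hb : b < 2 := by
          by_contra hb
          have s1 := h.le_of_le (Nat.zero_le a) (show 2 ≤ b by omega)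
          have s2 := h.transfer h.low (N + 1) 1 0 2 (by omega) (by omega)
          omega
        interval_cases b
        · have ha : a < 2 * N + 3 := by
            by_contra ha
            have s1 := t4 (N + 2 + (N + 1)) a (by omega)
            have s2 := t1 (N + 1)
            omega
          by_cases ha' : a < N + 2
          · exact Or.inl (Or.inl ⟨a, by omega, rfl, rfl⟩)
          · exact Or.inl (Or.inr ⟨a - (N + 2), by omega, Or.inr ⟨by omega, rfl⟩⟩)
        · have ha : a ≤ N + 1 := by
            by_contra ha
            have := h.lt_of_lt (show N + 1 ≤ a by omega) (le_refl 1) (Or.inl (by omega))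
            omega
          rcases ha.lt_or_eq with ha | rfl
          · exact Or.inl (Or.inr ⟨a, by omega, Or.inl ⟨rfl, rfl⟩⟩)
          · exact Or.inr ⟨rfl, rfl⟩
      · rintro ((⟨v, hv, rfl, rfl⟩ | ⟨m, hm, ⟨rfl, rfl⟩ | ⟨rfl, rfl⟩⟩) | ⟨rfl, rfl⟩)
        · exact h.le_of_le (by omega) (by omega)
        · exact h.le_of_le (by omega) (by omega)
        · have s1 := t2 m
          have s2 := t3 (m + 1) (N + 1) (by omega)
          omega
        · exact le_rfl
  rw [initialValues, hF, firstTwoBlocks, List.map_append, List.map_append, List.map_map,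
    List.map_flatMap, List.range'_eq_map_range, List.range'_eq_map_range, List.flatMap_map]
  congr 1
  congr 1
  · exact List.map_congr_left fun v _ => by simp [val, add_comm]
  · refine List.flatMap_congr fun m _ => ?_
    simp [val]; omega

end IsTypeOneEnum

/-! ### The limit of the construction for arbitrary choices -/

/-- `E` enumerates the pairs `(a, b)` in the order of the numbers `a + b θ`. -/
def IsLinearEnum (E : ℕ ≃ ℕ × ℕ) (θ : ℝ) : Prop :=
  ∀ a b c d : ℕ, E.symm (a, b) < E.symm (c, d) ↔ (a : ℝ) + b * θ < c + d * θ

/-- Irrationality makes `a + b θ` injective, and `θ > 0` leaves only finitely many pairs below any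
bound, so the set of values is order-isomorphic to `ℕ`. -/
theorem exists_isLinearEnum {θ : ℝ} (hθ : Irrational θ) (h0 : 0 < θ) :
    ∃ E : ℕ ≃ ℕ × ℕ, IsLinearEnum E θ := by
  let f : ℕ × ℕ → ℝ := fun p => (p.1 : ℝ) + p.2 * θ
  have hf : Function.Injective f := by
    rintro ⟨a, b⟩ ⟨c, d⟩ he
    simp only [f] at he
    have hbd : b = d := by
      by_contra hbd
      have hne : (b : ℝ) - d ≠ 0 := sub_ne_zero.2 (by exact_mod_cast hbd)
      refine hθ ⟨((c : ℚ) - a) / (b - d), ?_⟩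
      push_cast
      rw [div_eq_iff hne]
      linarith
    subst hbd
    have : (a : ℝ) = c := by linarith
    rw [Nat.cast_injective this]
  have hfin : ∀ x y : Set.range f, (Set.Icc x y).Finite := by
    intro x y
    obtain ⟨m, hm⟩ := exists_nat_gt (y : ℝ)
    obtain ⟨k, hk⟩ := exists_nat_gt ((y : ℝ) / θ)
    rw [div_lt_iff₀ h0] at hk
    refine Set.Finite.of_finite_image (f := Subtype.val) ?_ Subtype.val_injective.injOn
    refine (((Set.finite_Iio m).prod (Set.finite_Iio k)).image f).subset ?_
    rintro _ ⟨⟨_, ⟨a, b⟩, rfl⟩, ⟨-, hz⟩, rfl⟩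
    refine ⟨(a, b), ⟨?_, ?_⟩, rfl⟩
    all_goals
      have hz' : (a : ℝ) + b * θ ≤ y := hz
      have ha : (0 : ℝ) ≤ a := Nat.cast_nonneg a
      have hb : (0 : ℝ) ≤ b * θ := by positivity
    · have : (a : ℝ) < m := by linarith
      exact_mod_cast this
    · have : (b : ℝ) * θ < k * θ := by linarith
      exact_mod_cast lt_of_mul_lt_mul_right this h0.le
  let _ : LocallyFiniteOrder (Set.range f) := LocallyFiniteOrder.ofFiniteIcc hfin
  let _ : OrderBot (Set.range f) :=
    { bot := ⟨f (0, 0), ⟨_, rfl⟩⟩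
      bot_le := by
        rintro ⟨_, ⟨a, b⟩, rfl⟩
        change f (0, 0) ≤ f (a, b)
        have hb : (0 : ℝ) ≤ b * θ := by positivity
        have ha : (0 : ℝ) ≤ a := Nat.cast_nonneg a
        simp only [f, Nat.cast_zero]
        linarith }
  have _ : NoMaxOrder (Set.range f) := ⟨by
    rintro ⟨_, ⟨a, b⟩, rfl⟩
    exact ⟨⟨f (a + 1, b), ⟨_, rfl⟩⟩, show f (a, b) < f (a + 1, b) by
      simp only [f]; push_cast; linarith⟩⟩
  let _ : SuccOrder (Set.range f) := LinearLocallyFiniteOrder.succOrder _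
  let _ : PredOrder (Set.range f) := LinearLocallyFiniteOrder.predOrder _
  let i : Set.range f ≃o ℕ := orderIsoNatOfLinearSuccPredArch
  refine ⟨(i.symm.toEquiv.trans (Equiv.ofInjective f hf).symm), fun a b c d => ?_⟩
  change i (Equiv.ofInjective f hf (a, b)) < i (Equiv.ofInjective f hf (c, d)) ↔ _
  rw [i.lt_iff_lt]
  rfl

theorem IsLinearEnum.isMonoidEnum {E : ℕ ≃ ℕ × ℕ} {θ : ℝ} (hE : IsLinearEnum E θ) (h0 : 0 < θ) :
    IsMonoidEnum E where
  zero := by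
    rw [← E.eq_symm_apply, eq_comm]
    by_contra hn
    have h1 := (hE (E 0).1 (E 0).2 0 0).1 (by
      rw [Prod.mk.eta, E.symm_apply_apply]
      exact Nat.pos_of_ne_zero hn)
    have : (0 : ℝ) ≤ (E 0).1 + (E 0).2 * θ := by positivity
    simp only [Nat.cast_zero] at h1
    linarith
  fst p q hpq := by
    have := (hE p.1 p.2 q.1 q.2).1 hpq
    refine (hE _ _ _ _).2 ?_
    push_cast
    linarith
  snd p q hpq := by
    have := (hE p.1 p.2 q.1 q.2).1 hpq
    refine (hE _ _ _ _).2 ?_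
    push_cast
    linarith

/-- If no pair with positive coordinates lies between the neighbours `(0, k)` and `(l, 0)`, a small
change of the slope exchanges them, and preserves the order of all pairs `(a, b)` with `b < k`. -/
theorem exists_exchange {E : ℕ ≃ ℕ × ℕ} {θ : ℝ} (hE : IsLinearEnum E θ) (h0 : 0 < θ) {k l : ℕ}
    (hk : 0 < k) (hl : 0 < l)
    (hadj : ∀ a b, ¬(E.symm (0, k) < E.symm (a + 1, b + 1) ∧
        E.symm (a + 1, b + 1) < E.symm (l, 0)) ∧ ¬(E.symm (l, 0) < E.symm (a + 1, b + 1) ∧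
        E.symm (a + 1, b + 1) < E.symm (0, k))) :
    ∃ (θ' : ℝ) (E' : ℕ ≃ ℕ × ℕ), Irrational θ' ∧ 0 < θ' ∧ IsLinearEnum E' θ' ∧
      (E'.symm (0, k) < E'.symm (l, 0) ↔ ¬ E.symm (0, k) < E.symm (l, 0)) ∧
      ∀ a b c d : ℕ, b < k → d < k →
        (E.symm (a, b) < E.symm (c, d) ↔ E'.symm (a, b) < E'.symm (c, d)) := by
  have hkR : (0 : ℝ) < k := by exact_mod_cast hk
  have hlR : (0 : ℝ) < l := by exact_mod_cast hl
  have hk2 : (0 : ℝ) < 1 / (k * k) := by positivity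
  -- it suffices to preserve strict inequalities
  have suff : ∀ E' : ℕ ≃ ℕ × ℕ, (∀ a b c d : ℕ, b < k → d < k →
      E.symm (a, b) < E.symm (c, d) → E'.symm (a, b) < E'.symm (c, d)) →
      ∀ a b c d : ℕ, b < k → d < k →
        (E.symm (a, b) < E.symm (c, d) ↔ E'.symm (a, b) < E'.symm (c, d)) := by
    intro E' H a b c d hb hd
    refine ⟨H a b c d hb hd, fun hlt => ?_⟩
    by_contra hn
    rcases (not_lt.1 hn).lt_or_eq with hn | hn
    · exact lt_asymm hlt (H c d a b hd hb hn)
    · rw [E.symm.injective hn] at hlt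
      exact lt_irrefl _ hlt
  have hne : E.symm (0, k) ≠ E.symm (l, 0) := fun he => by
    have := (Prod.mk.inj (E.symm.injective he)).1
    omega
  rcases lt_or_gt_of_ne hne with hlt | hlt
  · have hθ0 : (k : ℝ) * θ < l := by simpa using (hE _ _ _ _).1 hlt
    -- The new slope lies just beyond `l / k`. The margin `1 / k ^ 2` is small enough for the
    -- integrality argument below, where denominators are less than `k`.
    obtain ⟨θ', hirr, h1, h2⟩ := exists_irrational_btwn
      (show (l : ℝ) / k < l / k + 1 / (k * k) by linarith)
    have h1' : (l : ℝ) < θ' * k := (div_lt_iff₀ hkR).1 h1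
    have h2' : θ' * k < l + 1 / k := by
      have := mul_lt_mul_of_pos_right h2 hkR
      have e : ((l : ℝ) / k + 1 / (k * k)) * k = l + 1 / k := by field_simp
      linarith
    have hpos : 0 < θ' := (div_pos hlR hkR).trans h1
    have hθθ' : θ < θ' := by
      by_contra hn
      have := mul_le_mul_of_nonneg_right (not_lt.1 hn) hkR.le
      linarith
    obtain ⟨E', hE'⟩ := exists_isLinearEnum hirr hpos
    refine ⟨θ', E', hirr, hpos, hE', ?_, suff E' ?_⟩
    · rw [hE', iff_not_comm, iff_true_left hlt]
      simp only [Nat.cast_zero]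
      linarith
    · intro a b c d hb hd hlt'
      rw [hE] at hlt'
      rw [hE']
      rcases le_or_gt b d with hbd | hbd
      · have : (0 : ℝ) ≤ (d - b) * (θ' - θ) :=
          mul_nonneg (sub_nonneg.2 (by exact_mod_cast hbd)) (by linarith)
        linarith
      · obtain ⟨B, rfl⟩ := Nat.exists_eq_add_of_lt hbd
        push_cast at hlt' ⊢
        have hB : (0 : ℝ) < (B + 1) * θ := by positivity
        have hac : a < c := by
          have : (a : ℝ) < c := by linarith
          exact_mod_cast this
        obtain ⟨A, rfl⟩ := Nat.exists_eq_add_of_lt hac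
        push_cast at hlt' ⊢
        by_contra hn
        have hBk : B + 1 < k := by omega
        obtain ⟨D, rfl⟩ := Nat.exists_eq_add_of_lt hBk
        have hB1 : ((B : ℝ) + 1) / ((B + 1 + D + 1 : ℕ) : ℝ) < 1 := by
          rw [div_lt_one hkR]
          push_cast
          have : (0 : ℝ) ≤ D := Nat.cast_nonneg D
          linarith
        -- A reversed comparison means `θ < (A + 1) / (B + 1) ≤ θ'`. Then `(A + 1) k < (B + 1) l +
        -- 1`, and integrality removes the `+ 1`. With `D + 1 = k - (B + 1)`, the pair `(A + 1, D +
        -- 1)` lies between `(0, k)` and `(l, 0)`, contrary to `hadj`.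
        have hA : (A + 1) * (B + 1 + D + 1) ≤ (B + 1) * l := by
          have s1 : ((A : ℝ) + 1) ≤ (B + 1) * θ' := by linarith
          have s2 := mul_le_mul_of_nonneg_right s1 hkR.le
          have s3 := mul_lt_mul_of_pos_left h2' (show (0 : ℝ) < B + 1 by positivity)
          have s4 : ((B : ℝ) + 1) * (l + 1 / ((B + 1 + D + 1 : ℕ) : ℝ)) =
              (B + 1) * l + (B + 1) / ((B + 1 + D + 1 : ℕ) : ℝ) := by ring
          have s5 : (((A + 1) * (B + 1 + D + 1) : ℕ) : ℝ) < (((B + 1) * l + 1 : ℕ) : ℝ) := by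
            push_cast at s2 s3 s4 hB1 ⊢
            nlinarith
          exact Nat.lt_succ_iff.1 (by exact_mod_cast s5)
        have hAR : ((A : ℝ) + 1) * (B + 1 + D + 1) ≤ (B + 1) * l := by exact_mod_cast hA
        push_cast at hθ0
        refine (hadj A D).1 ⟨?_, ?_⟩
        · rw [hE]
          push_cast
          linarith
        · rw [hE]
          push_cast
          have hD : (0 : ℝ) < D + 1 := by positivity
          have s1 := mul_lt_mul_of_pos_left hθ0 hD
          have hK : (0 : ℝ) < B + 1 + D + 1 := by positivity
          refine lt_of_mul_lt_mul_right ?_ hK.le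
          linarith
  · have hθ0 : (l : ℝ) < k * θ := by simpa using (hE _ _ _ _).1 hlt
    -- The mirror image: `θ'` lies just below `l / k`, and the maximum with `0` keeps it positive.
    obtain ⟨θ', hirr, h1, h2⟩ := exists_irrational_btwn
      (show max 0 ((l : ℝ) / k - 1 / (k * k)) < l / k from
        max_lt (div_pos hlR hkR) (by linarith))
    have h2' : θ' * k < l := (lt_div_iff₀ hkR).1 h2
    have h1' : (l : ℝ) - 1 / k < θ' * k := by
      have := mul_lt_mul_of_pos_right ((le_max_right _ _).trans_lt h1) hkR
      have e : ((l : ℝ) / k - 1 / (k * k)) * k = l - 1 / k := by field_simp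
      linarith
    have hpos : 0 < θ' := (le_max_left _ _).trans_lt h1
    have hθθ' : θ' < θ := by
      by_contra hn
      have := mul_le_mul_of_nonneg_right (not_lt.1 hn) hkR.le
      linarith
    obtain ⟨E', hE'⟩ := exists_isLinearEnum hirr hpos
    refine ⟨θ', E', hirr, hpos, hE', ?_, suff E' ?_⟩
    · rw [hE', iff_true_right (not_lt.2 hlt.le)]
      simp only [Nat.cast_zero]
      linarith
    · intro a b c d hb hd hlt'
      rw [hE] at hlt'
      rw [hE']
      rcases le_or_gt d b with hbd | hbd
      · have : (0 : ℝ) ≤ (b - d) * (θ - θ') :=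
          mul_nonneg (sub_nonneg.2 (by exact_mod_cast hbd)) (by linarith)
        linarith
      · obtain ⟨B, rfl⟩ := Nat.exists_eq_add_of_lt hbd
        push_cast at hlt' ⊢
        have hB : (0 : ℝ) < (B + 1) * θ' := by positivity
        rcases le_or_gt a c with hac | hac
        · have : (a : ℝ) ≤ c := by exact_mod_cast hac
          linarith
        obtain ⟨A, rfl⟩ := Nat.exists_eq_add_of_lt hac
        push_cast at hlt' ⊢
        by_contra hn
        have hBk : B + 1 < k := by omega
        obtain ⟨D, rfl⟩ := Nat.exists_eq_add_of_lt hBk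
        have hB1 : ((B : ℝ) + 1) / ((B + 1 + D + 1 : ℕ) : ℝ) < 1 := by
          rw [div_lt_one hkR]
          push_cast
          have : (0 : ℝ) ≤ D := Nat.cast_nonneg D
          linarith
        have hA : (B + 1) * l ≤ (A + 1) * (B + 1 + D + 1) := by
          have s1 : (B + 1) * θ' ≤ ((A : ℝ) + 1) := by linarith
          have s2 := mul_le_mul_of_nonneg_right s1 hkR.le
          have s3 := mul_lt_mul_of_pos_left h1' (show (0 : ℝ) < B + 1 by positivity)
          have s4 : ((B : ℝ) + 1) * (l - 1 / ((B + 1 + D + 1 : ℕ) : ℝ)) =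
              (B + 1) * l - (B + 1) / ((B + 1 + D + 1 : ℕ) : ℝ) := by ring
          have s5 : (((B + 1) * l : ℕ) : ℝ) < (((A + 1) * (B + 1 + D + 1) + 1 : ℕ) : ℝ) := by
            push_cast at s2 s3 s4 hB1 ⊢
            nlinarith
          exact Nat.lt_succ_iff.1 (by exact_mod_cast s5)
        have hAR : (B + 1) * l ≤ ((A : ℝ) + 1) * (B + 1 + D + 1) := by exact_mod_cast hA
        push_cast at hθ0
        refine (hadj A D).2 ⟨?_, ?_⟩
        · rw [hE]
          push_cast
          have hD : (0 : ℝ) < D + 1 := by positivity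
          have s1 := mul_lt_mul_of_pos_left hθ0 hD
          have hK : (0 : ℝ) < B + 1 + D + 1 := by positivity
          refine lt_of_mul_lt_mul_right ?_ hK.le
          linarith
        · rw [hE]
          push_cast
          linarith

theorem seg_congr {E E' : ℕ ≃ ℕ × ℕ} {a b : ℕ} (h : ∀ i < b, E' i = E i) :
    seg E' a b = seg E a b := by
  refine List.map_congr_left fun i hi => h i ?_
  rw [List.mem_range'_1] at hi
  omega

theorem getD_initialValues {E : ℕ ≃ ℕ × ℕ} {p : ℕ × ℕ} {i : ℕ} (hi : i ≤ E.symm p) :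
    (initialValues E p).getD i 0 = val (E i) := by
  rw [List.getD_eq_getElem?_getD, initialValues, List.getElem?_map, seg, List.getElem?_map,
    List.getElem?_range' (by omega)]
  simp

/-- The position of `p` is the number of pairs before it. -/
theorem symm_eq_of_lt_iff {E E' : ℕ ≃ ℕ × ℕ} {p : ℕ × ℕ}
    (h : ∀ q, E.symm q < E.symm p ↔ E'.symm q < E'.symm p) : E'.symm p = E.symm p := by
  have : (Finset.range (E'.symm p)).map E'.toEmbedding =
      (Finset.range (E.symm p)).map E.toEmbedding := by
    ext q
    simp only [Finset.mem_map_equiv, Finset.mem_range]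
    exact (h q).symm
  simpa using congrArg Finset.card this

/-! ### Growth of the stages, and realisation of a free choice. -/

namespace IsTypeOneEnum

variable {E : ℕ ≃ ℕ × ℕ} {N K l : ℕ}

theorem lt_symm (h : IsTypeOneEnum E N) (b : ℕ) : b < E.symm (N + 1, b) := by
  induction b with
  | zero =>
    have := h.lt_of_lt (Nat.zero_le (N + 1)) (le_refl 0) (Or.inl (Nat.succ_pos N))
    omega
  | succ b ih =>
    have := h.lt_of_lt (le_refl (N + 1)) (Nat.le_succ b) (Or.inr (Nat.lt_succ_self b))
    have : E.symm (N + 1, b) < E.symm (N + 1, b + 1) := this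
    omega

/-- Since `(v + 1, j) < (v, j + 1)`, first coordinates can be traded for second ones. Thus every
pair is reached at a stage that depends only on its coordinate sum, whatever the enumeration. -/
theorem le_symm (h : IsTypeOneEnum E N) {v j b : ℕ} (hb : v + j ≤ b + 1) :
    E.symm (v, j) ≤ E.symm (N + 1, b + 1) := by
  induction v generalizing j with
  | zero => exact h.le_of_le (Nat.zero_le _) (by omega)
  | succ v ih =>
    have h1 := h.transfer h.one_lt (v + 1) j v (j + 1) (by omega) (by omega)
    have h2 := ih (show v + (j + 1) ≤ b + 1 by omega)
    omega

theorem symm_of_le (h : IsTypeOneEnum E N) {v : ℕ} (hv : v ≤ N + 1) : E.symm (v, 0) = v := by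
  have h1 : (seg E 0 (E.symm (v, 0))) = (List.range v).map fun u => (u, 0) := by
    refine eq_of_sorted E.symm (sorted_seg _ _ _) ?_ ?_
    · rw [List.pairwise_map]
      exact List.pairwise_lt_range.imp fun hab => h.lt_of_lt hab.le le_rfl (Or.inl hab)
    · rintro ⟨a, b⟩
      simp only [mem_seg, List.mem_map, List.mem_range, Prod.mk.injEq]
      constructor
      · rintro ⟨-, hlt⟩
        have hb : b = 0 := by
          by_contra hb
          have s1 := h.le_of_le (Nat.zero_le a) (show 1 ≤ b by omega)
          have s2 := h.low
          have s3 := h.le_of_le hv (le_refl 0)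
          omega
        subst hb
        refine ⟨a, ?_, rfl, rfl⟩
        by_contra ha
        have := h.le_of_le (not_lt.1 ha) (le_refl 0)
        omega
      · rintro ⟨u, hu, rfl, rfl⟩
        exact ⟨Nat.zero_le _, h.lt_of_lt hu.le le_rfl (Or.inl hu)⟩
  simpa [length_seg] using congrArg List.length h1

theorem symm_zero_one (h : IsTypeOneEnum E N) : E.symm (0, 1) = N + 2 := by
  have h1 : (seg E 0 (E.symm (0, 1))) = seg E 0 (E.symm (N + 1, 0) + 1) := by
    refine eq_of_sorted E.symm (sorted_seg _ _ _) (sorted_seg _ _ _) ?_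
    rintro ⟨a, b⟩
    have hlow := h.low
    rw [mem_seg, mem_seg]
    refine ⟨fun hlt => ⟨Nat.zero_le _, ?_⟩, fun hlt => ⟨Nat.zero_le _, by omega⟩⟩
    have hb : b = 0 := by
      by_contra hb
      have s1 := h.le_of_le (Nat.zero_le a) (show 1 ≤ b by omega)
      omega
    subst hb
    have ha : a ≤ N + 1 := by
      by_contra ha
      have := h.le_of_le (show N + 2 ≤ a by omega) (le_refl 0)
      have := h.high
      omega
    exact Nat.lt_succ_of_le (h.le_of_le ha le_rfl)
  have := congrArg List.length h1
  rw [length_seg, length_seg, h.symm_of_le le_rfl] at this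
  omega

/-- Every choice at the next step agrees with a suitable linear enumeration. -/
theorem exists_linearEnum_extend {θ : ℝ} (h : IsTypeOneEnum E N) (h0 : 0 < θ) (hθ : Irrational θ)
    (hE : IsLinearEnum E θ) (K : ℕ) (o : Bool) :
    ∃ (θ' : ℝ) (E' : ℕ ≃ ℕ × ℕ), Irrational θ' ∧ 0 < θ' ∧ IsLinearEnum E' θ' ∧
      IsTypeOneEnum E' N ∧ (∀ i ≤ E.symm (N + 1, K + 1), E' i = E i) ∧
      extend (N + 2) (K + 2) o (initialValues E (N + 1, K + 1)) =
        initialValues E' (N + 1, K + 2) := by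
  obtain ⟨l, hl, hell⟩ := h.exists_new K
  by_cases hadj : ∀ a b, ¬(E.symm (0, K + 2) < E.symm (a + 1, b + 1) ∧
      E.symm (a + 1, b + 1) < E.symm (l, 0)) ∧ ¬(E.symm (l, 0) < E.symm (a + 1, b + 1) ∧
      E.symm (a + 1, b + 1) < E.symm (0, K + 2))
  swap
  · exact ⟨θ, E, hθ, h0, hE, h, fun _ _ => rfl, h.extend_eq hl hell o fun hh => absurd hh hadj⟩
  by_cases ho : o = true ↔ E.symm (0, K + 2) < E.symm (l, 0)
  · exact ⟨θ, E, hθ, h0, hE, h, fun _ _ => rfl, h.extend_eq hl hell o fun _ => ho⟩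
  -- The choice contradicts `E`, so the two neighbours are exchanged. All pairs up to `(N + 1, K +
  -- 1)` have second coordinate below `K + 2`, hence keep their positions.
  obtain ⟨θ', E', hθ', h0', hE', hex, hag⟩ :=
    exists_exchange hE h0 (Nat.succ_pos (K + 1)) (h.new_pos hl) hadj
  have h' : IsTypeOneEnum E' N :=
    { hE'.isMonoidEnum h0' with
      low := (hag _ _ _ _ (by omega) (by omega)).1 h.low
      high := (hag _ _ _ _ (by omega) (by omega)).1 h.high }
  have hsymm : ∀ p, E.symm p ≤ E.symm (N + 1, K + 1) → E'.symm p = E.symm p := by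
    rintro ⟨a, b⟩ hp
    have hX := h.lt_one K
    have hX' := h'.lt_one K
    have hb : b < K + 2 := by
      by_contra hb
      have := h.le_of_le (Nat.zero_le a) (not_lt.1 hb)
      omega
    have hp' : E'.symm (a, b) ≤ E'.symm (N + 1, K + 1) := by
      rw [← not_lt] at hp ⊢
      rwa [← hag _ _ _ _ (by omega) hb]
    refine symm_eq_of_lt_iff ?_
    rintro ⟨c, d⟩
    by_cases hd : d < K + 2
    · exact hag _ _ _ _ hd hb
    · have s1 := h.le_of_le (Nat.zero_le c) (not_lt.1 hd)
      have s2 := h'.le_of_le (Nat.zero_le c) (not_lt.1 hd)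
      omega
  have hagree : ∀ i ≤ E.symm (N + 1, K + 1), E' i = E i := by
    intro i hi
    have := hsymm (E i) (by rwa [E.symm_apply_apply])
    rw [E.symm_apply_apply, E'.symm_apply_eq] at this
    exact this.symm
  have hiv : initialValues E' (N + 1, K + 1) = initialValues E (N + 1, K + 1) := by
    rw [initialValues, hsymm _ le_rfl, seg_congr fun i hi => hagree i (Nat.le_of_lt_succ hi)]
    rfl
  have hl' : IsNewValue E' N K l :=
    ⟨(hag _ _ _ _ (by omega) (by omega)).1 hl.lt,
      fun u hu => (hag _ _ _ _ (by omega) (by omega)).1 (hl.of_lt u hu)⟩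
  refine ⟨θ', E', hθ', h0', hE', h', hagree, ?_⟩
  rw [← hiv]
  refine h'.extend_eq hl' (by rw [hiv, hell]) o fun _ => ?_
  rw [hex]
  tauto

end IsTypeOneEnum

/-- The sequence built by the procedure enumerates the first coordinates of a translation-invariant
enumeration. -/
theorem exists_enum_of_choices (N : ℕ) (c : ℕ → Bool) :
    ∃ E : ℕ ≃ ℕ × ℕ, IsTypeOneEnum E N ∧ typeOne (N + 2) c = fun k => val (E k) := by
  -- Linearity is carried along only so that the next exchange is possible; it is not claimed for
  -- the limit.
  let Inv : ℕ → (ℕ ≃ ℕ × ℕ) → Prop := fun b E => IsTypeOneEnum E N ∧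
    (∃ θ : ℝ, 0 < θ ∧ Irrational θ ∧ IsLinearEnum E θ) ∧
    stage (N + 2) c b = initialValues E (N + 1, b + 1)
  obtain ⟨E₀, hE₀⟩ : ∃ E₀, Inv 0 E₀ := by
    obtain ⟨θ, hθ, h1, h2⟩ := exists_irrational_btwn
      (show ((N : ℝ) + 1) < N + 2 by linarith)
    have h0 : 0 < θ := lt_trans (by positivity) h1
    obtain ⟨E, hE⟩ := exists_isLinearEnum hθ h0
    have h : IsTypeOneEnum E N :=
      { hE.isMonoidEnum h0 with
        low := by rw [hE]; push_cast; linarith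
        high := by rw [hE]; push_cast; linarith }
    exact ⟨E, h, ⟨θ, h0, hθ, hE⟩, h.initialValues_one.symm⟩
  have step : ∀ b E, Inv b E → ∃ E', Inv (b + 1) E' ∧
      ∀ i ≤ E.symm (N + 1, b + 1), E' i = E i := by
    rintro b E ⟨h, ⟨θ, h0, hθ, hE⟩, hs⟩
    obtain ⟨θ', E', hθ', h0', hE', h', hag, hx⟩ := h.exists_linearEnum_extend h0 hθ hE b (c b)
    exact ⟨E', ⟨h', ⟨θ', h0', hθ', hE'⟩, by rw [stage, hs, hx]⟩, hag⟩
  choose! g hg using step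
  let F : ℕ → (ℕ ≃ ℕ × ℕ) := fun b => Nat.rec E₀ (fun b E => g b E) b
  have hF : ∀ b, Inv b (F b) := by
    intro b
    induction b with
    | zero => exact hE₀
    | succ b ih => exact (hg b _ ih).1
  have hlt : ∀ b, b + 1 < (F b).symm (N + 1, b + 1) := fun b => (hF b).1.lt_symm _
  have hsucc : ∀ b, ∀ i ≤ (F b).symm (N + 1, b + 1), F (b + 1) i = F b i := fun b =>
    (hg b _ (hF b)).2
  have hmono : ∀ b, (F b).symm (N + 1, b + 1) ≤ (F (b + 1)).symm (N + 1, b + 1 + 1) := by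
    intro b
    have h1 : (F (b + 1)).symm (N + 1, b + 1) = (F b).symm (N + 1, b + 1) := by
      rw [Equiv.symm_apply_eq, hsucc b _ le_rfl, Equiv.apply_symm_apply]
    rw [← h1]
    exact (hF (b + 1)).1.le_of_le le_rfl (Nat.le_succ _)
  have hagree : ∀ b b', b ≤ b' → ∀ i ≤ (F b).symm (N + 1, b + 1), F b' i = F b i := by
    intro b b' hb
    have : (F b).symm (N + 1, b + 1) ≤ (F b').symm (N + 1, b' + 1) ∧
        ∀ i ≤ (F b).symm (N + 1, b + 1), F b' i = F b i := by
      induction b', hb using Nat.le_induction with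
      | base => exact ⟨le_rfl, fun _ _ => rfl⟩
      | succ b' _ ih =>
        refine ⟨ih.1.trans (hmono b'), fun i hi => ?_⟩
        rw [hsucc b' i (hi.trans ih.1), ih.2 i hi]
    exact this.2
  -- The diagonal is the pointwise limit, as `F i` is already final at position `i`.
  let e : ℕ → ℕ × ℕ := fun i => F i i
  have he : ∀ b, ∀ i ≤ (F b).symm (N + 1, b + 1), e i = F b i := by
    intro b i hi
    rcases le_total i b with h | h
    · exact (hagree i b h i (by have := hlt i; omega)).symm
    · exact hagree b i h i hi
  have hsymm : ∀ b p, p.1 + p.2 ≤ b + 1 → e ((F b).symm p) = p := by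
    rintro b ⟨v, j⟩ hp
    rw [he b _ ((hF b).1.le_symm hp), Equiv.apply_symm_apply]
  have hbij : Function.Bijective e := by
    constructor
    · intro i i' hii
      have h1 := hlt (i + i')
      rw [he (i + i') i (by omega), he (i + i') i' (by omega)] at hii
      exact (F (i + i')).injective hii
    · intro p
      exact ⟨_, hsymm (p.1 + p.2) p (by omega)⟩
  let E := Equiv.ofBijective e hbij
  have hEs : ∀ b p, p.1 + p.2 ≤ b + 1 → E.symm p = (F b).symm p := fun b p hp => by
    rw [Equiv.symm_apply_eq]
    exact (hsymm b p hp).symm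
  have hval : typeOne (N + 2) c = fun k => val (E k) := by
    funext k
    have := hlt k
    rw [typeOne, (hF k).2.2, getD_initialValues (by omega)]
    rfl
  refine ⟨E, ⟨⟨?_, ?_, ?_⟩, ?_, ?_⟩, hval⟩
  · exact (hF 0).1.zero
  · intro p q hpq
    -- This stage settles the positions of `p`, `q` and their translates, so invariance is inherited
    -- from it.
    rw [hEs (p.1 + p.2 + (q.1 + q.2)) _ (by omega),
      hEs (p.1 + p.2 + (q.1 + q.2)) _ (by omega)] at hpq
    rw [hEs (p.1 + p.2 + (q.1 + q.2)) _ (by dsimp only; omega),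
      hEs (p.1 + p.2 + (q.1 + q.2)) _ (by dsimp only; omega)]
    exact (hF _).1.fst _ _ hpq
  · intro p q hpq
    rw [hEs (p.1 + p.2 + (q.1 + q.2)) _ (by omega),
      hEs (p.1 + p.2 + (q.1 + q.2)) _ (by omega)] at hpq
    rw [hEs (p.1 + p.2 + (q.1 + q.2)) _ (by dsimp only; omega),
      hEs (p.1 + p.2 + (q.1 + q.2)) _ (by dsimp only; omega)]
    exact (hF _).1.snd _ _ hpq
  · rw [hEs (N + 1) _ (by simp), hEs (N + 1) _ (by simp)]
    exact (hF (N + 1)).1.low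
  · rw [hEs (N + 1) _ (by simp), hEs (N + 1) _ (by simp)]
    exact (hF (N + 1)).1.high

/-- Suitable choices produce any given translation-invariant enumeration. -/
theorem exists_choices_of_enum {E : ℕ ≃ ℕ × ℕ} {N : ℕ} (h : IsTypeOneEnum E N) :
    ∃ c : ℕ → Bool, typeOne (N + 2) c = fun k => val (E k) := by
  choose l hl hell using h.exists_new
  refine ⟨fun b => decide (E.symm (0, b + 2) < E.symm (l b, 0)), ?_⟩
  have hs : ∀ b, stage (N + 2) (fun b => decide (E.symm (0, b + 2) < E.symm (l b, 0))) b =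
      initialValues E (N + 1, b + 1) := by
    intro b
    induction b with
    | zero => exact h.initialValues_one.symm
    | succ b ih =>
      rw [stage, ih]
      exact h.extend_eq (hl b) (hell b) _ fun _ => by simp
  funext k
  have := h.lt_symm (k + 1)
  rw [typeOne, hs, getD_initialValues (by omega)]

/-! ### Doubly fractal sequences and enumerations -/

/-- The embeddings that witness the two trimmings are the translations by `(0, 1)` and `(1, 0)`,
read on positions. -/
theorem IsMonoidEnum.isDoublyFractal {E : ℕ ≃ ℕ × ℕ} (h : IsMonoidEnum E) :
    IsDoublyFractal fun k => val (E k) where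
  pos k := Nat.succ_pos _
  occurs v hv := ⟨E.symm (v - 1, 0), by simp only [val, E.apply_symm_apply]; omega⟩
  first := by simp [val, h.zero]
  upper := by
    refine ⟨fun k => E.symm ((E k).1, (E k).2 + 1), fun i j hij => ?_, ?_, fun k => by simp [val]⟩
    · exact h.snd (E i) (E j) (by simpa using hij)
    · ext k
      simp only [Set.mem_range, Set.mem_ofPred_eq]
      constructor
      · rintro ⟨i, rfl⟩
        refine ⟨i, ?_, by simp [val]⟩
        have := h.lt_of_lt (le_refl (E i).1) (Nat.le_succ (E i).2) (Or.inr (Nat.lt_succ_self _))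
        simpa using this
      · rintro ⟨i, hik, he⟩
        have he' : (E i).1 = (E k).1 := by simpa [val] using he
        have h2 : (E k).2 ≠ 0 := by
          intro h0
          have := h.le_of_le (le_of_eq he'.symm) (show (E k).2 ≤ (E i).2 by omega)
          simp at this
          omega
        refine ⟨E.symm ((E k).1, (E k).2 - 1), ?_⟩
        rw [E.symm_apply_eq, E.apply_symm_apply]
        exact Prod.ext rfl (by dsimp only; omega)
  lower := by
    refine ⟨fun k => E.symm ((E k).1 + 1, (E k).2), fun i j hij => ?_, ?_, fun k => by simp [val]⟩
    · exact h.fst (E i) (E j) (by simpa using hij)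
    · ext k
      simp only [Set.mem_range, Set.mem_ofPred_eq]
      constructor
      · rintro ⟨i, rfl⟩
        simp [val]
      · intro hk
        have hk' : (E k).1 ≠ 0 := by simpa [val] using hk
        refine ⟨E.symm ((E k).1 - 1, (E k).2), ?_⟩
        rw [E.symm_apply_eq, E.apply_symm_apply]
        exact Prod.ext (by dsimp only; omega) rfl

/-- The number of earlier occurrences of the `k`-th term. -/
def earlier (S : ℕ → ℕ) (k : ℕ) : ℕ := ((Finset.range k).filter fun i => S i = S k).card

theorem earlier_lt {S : ℕ → ℕ} {i k : ℕ} (hik : i < k) (he : S i = S k) :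
    earlier S i < earlier S k := by
  refine Finset.card_lt_card ⟨fun j hj => ?_, fun hs => ?_⟩
  · simp only [Finset.mem_filter, Finset.mem_range] at hj ⊢
    exact ⟨by omega, hj.2.trans he⟩
  · have := hs (Finset.mem_filter.2 ⟨Finset.mem_range.2 hik, he⟩)
    simp at this

theorem earlier_injective (S : ℕ → ℕ) {i k : ℕ} (he : S i = S k)
    (h : earlier S i = earlier S k) : i = k := by
  rcases lt_trichotomy i k with hlt | hlt | hlt
  · have := earlier_lt hlt he; omega
  · exact hlt
  · have := earlier_lt hlt he.symm; omega

/-- Under a strictly monotone map onto a set `K`, the earlier positions in `K` with a given value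
correspond to the earlier positions. -/
theorem card_filter_range_of_strictMono {S : ℕ → ℕ} {φ : ℕ → ℕ} (hφ : StrictMono φ) (k : ℕ)
    [DecidablePred fun i => S i = S (φ k) ∧ i ∈ Set.range φ]
    (hS : ∀ i, S (φ i) = S (φ k) ↔ S i = S k) :
    ((Finset.range (φ k)).filter fun i => S i = S (φ k) ∧ i ∈ Set.range φ).card =
      earlier S k := by
  rw [earlier]
  symm
  refine Finset.card_bij (fun i _ => φ i) ?_ (fun a _ b _ hab => hφ.injective hab) ?_
  · intro i hi
    simp only [Finset.mem_filter, Finset.mem_range] at hi ⊢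
    exact ⟨hφ hi.1, (hS i).2 hi.2, ⟨i, rfl⟩⟩
  · intro j hj
    simp only [Finset.mem_filter, Finset.mem_range] at hj
    obtain ⟨hjk, hSj, i, rfl⟩ := hj
    refine ⟨i, ?_, rfl⟩
    simp only [Finset.mem_filter, Finset.mem_range]
    exact ⟨hφ.lt_iff_lt.1 hjk, (hS i).1 hSj⟩

/-- The trimming embedding `φ` keeps the value and raises the occurrence count by one; `ψ` raises
the value and keeps the count. In the coordinates `(S k - 1, earlier S k)` they are the unit
translations, and their monotonicity is the invariance of the order. -/
theorem IsDoublyFractal.exists_enum {S : ℕ → ℕ} (hS : IsDoublyFractal S) :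
    ∃ E : ℕ ≃ ℕ × ℕ, IsMonoidEnum E ∧ S = fun k => val (E k) := by
  obtain ⟨φ, hφ, hφr, hφS⟩ := hS.upper
  obtain ⟨ψ, hψ, hψr, hψS⟩ := hS.lower
  have hφS' : ∀ k, S (φ k) = S k := fun k => (hφS k).symm
  have hψ2 : ∀ k, S (ψ k) - 1 ≠ 0 := fun k => by
    have : ψ k ∈ Set.range ψ := ⟨k, rfl⟩
    rw [hψr] at this
    exact this
  have hψS' : ∀ k, S (ψ k) = S k + 1 := fun k => by
    have h1 : S k = S (ψ k) - 1 := hψS k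
    have := hψ2 k
    omega
  have eφ : ∀ k, earlier S (φ k) = earlier S k + 1 := by
    intro k
    have hmem : ∃ i, S i = S (φ k) := ⟨φ k, rfl⟩
    classical
    -- Among the occurrences of one value, upper trimming loses exactly the first.
    have hmin : ∀ j, S j = S (φ k) → (j ∉ Set.range φ ↔ j = Nat.find hmem) := by
      intro j hj
      rw [hφr, Set.mem_ofPred_eq]
      constructor
      · intro hn
        by_contra hne
        exact hn ⟨Nat.find hmem, lt_of_le_of_ne (Nat.find_min' hmem hj) (Ne.symm hne),
          (Nat.find_spec hmem).trans hj.symm⟩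
      · rintro rfl ⟨i, hi, he⟩
        exact Nat.find_min hmem hi (he.trans hj)
    have hfirst : Nat.find hmem < φ k := by
      refine lt_of_le_of_ne (Nat.find_min' hmem rfl) fun he => ?_
      exact (hmin _ rfl).2 he.symm ⟨k, rfl⟩
    have hsplit : ((Finset.range (φ k)).filter fun i => S i = S (φ k)) =
        insert (Nat.find hmem)
          ((Finset.range (φ k)).filter fun i => S i = S (φ k) ∧ i ∈ Set.range φ) := by
      ext j
      simp only [Finset.mem_insert, Finset.mem_filter, Finset.mem_range]
      constructor
      · rintro ⟨h1, h2⟩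
        by_cases h3 : j ∈ Set.range φ
        · exact Or.inr ⟨h1, h2, h3⟩
        · exact Or.inl ((hmin j h2).1 h3)
      · rintro (rfl | ⟨h1, h2, -⟩)
        · exact ⟨hfirst, Nat.find_spec hmem⟩
        · exact ⟨h1, h2⟩
    rw [earlier, hsplit, Finset.card_insert_of_notMem, card_filter_range_of_strictMono hφ]
    · intro i
      rw [hφS', hφS']
    · simp only [Finset.mem_filter, not_and]
      exact fun _ h2 => (hmin _ h2).2 rfl
  have eψ : ∀ k, earlier S (ψ k) = earlier S k := by
    intro k
    classical
    rw [← card_filter_range_of_strictMono hψ k (fun i => by rw [hψS', hψS']; omega), earlier]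
    refine congrArg Finset.card (Finset.ext fun i => ?_)
    rw [Finset.mem_filter, Finset.mem_filter]
    refine and_congr_right fun _ => (and_iff_left_of_imp fun hi => ?_).symm
    rw [hψr]
    change S i - 1 ≠ 0
    rw [hi]
    exact hψ2 k
  let e : ℕ → ℕ × ℕ := fun k => (S k - 1, earlier S k)
  have hbij : Function.Bijective e := by
    constructor
    · intro i k hik
      obtain ⟨h1, h2⟩ := Prod.mk.inj hik
      have := hS.pos i
      have := hS.pos k
      exact earlier_injective S (by omega) h2
    -- The pair `(v, 0)` is the first occurrence of `v + 1`; applying `φ` climbs from `(v, j)` to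
    -- `(v, j + 1)`.
    · rintro ⟨v, j⟩
      induction j with
      | zero =>
        have hex := hS.occurs (v + 1) (Nat.succ_pos v)
        classical
        refine ⟨Nat.find hex, Prod.ext ?_ ?_⟩
        · have := Nat.find_spec hex
          dsimp only [e]; omega
        · dsimp only [e]
          rw [earlier, Finset.card_eq_zero, Finset.filter_eq_empty_iff]
          intro i hi he
          exact Nat.find_min hex (Finset.mem_range.1 hi) (he.trans (Nat.find_spec hex))
      | succ j ih =>
        obtain ⟨k, hk⟩ := ih
        obtain ⟨h1, h2⟩ := Prod.mk.inj hk
        exact ⟨φ k, Prod.ext (by dsimp only [e]; rw [hφS', h1])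
          (by dsimp only [e]; rw [eφ, h2])⟩
  let E := Equiv.ofBijective e hbij
  have hEφ : ∀ p, E.symm (p.1, p.2 + 1) = φ (E.symm p) := by
    intro p
    rw [Equiv.symm_apply_eq]
    obtain ⟨k, rfl⟩ := E.surjective p
    rw [E.symm_apply_apply]
    exact Prod.ext (by change S k - 1 = S (φ k) - 1; rw [hφS'])
      (by change earlier S k + 1 = earlier S (φ k); rw [eφ])
  have hEψ : ∀ p, E.symm (p.1 + 1, p.2) = ψ (E.symm p) := by
    intro p
    rw [Equiv.symm_apply_eq]
    obtain ⟨k, rfl⟩ := E.surjective p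
    rw [E.symm_apply_apply]
    refine Prod.ext ?_ ?_
    · change S k - 1 + 1 = S (ψ k) - 1
      have := hS.pos k
      rw [hψS']; omega
    · change earlier S k = earlier S (ψ k)
      rw [eψ]
  refine ⟨E, ⟨?_, ?_, ?_⟩, ?_⟩
  · refine Prod.ext ?_ ?_
    · change S 0 - 1 = 0
      rw [hS.first]
    · change earlier S 0 = 0
      simp [earlier]
  · intro p q hpq
    rw [hEψ, hEψ]
    exact hψ hpq
  · intro p q hpq
    rw [hEφ, hEφ]
    exact hφ hpq
  · funext k
    change S k = S k - 1 + 1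
    have := hS.pos k
    omega

/-! ### Exchange of coordinates and type 2. -/

theorem IsMonoidEnum.swap {E : ℕ ≃ ℕ × ℕ} (h : IsMonoidEnum E) :
    IsMonoidEnum (E.trans (Equiv.prodComm ℕ ℕ)) where
  zero := by simp [h.zero]
  fst p q hpq := h.snd p.swap q.swap hpq
  snd p q hpq := h.fst p.swap q.swap hpq

theorem IsMonoidEnum.earlier_val {E : ℕ ≃ ℕ × ℕ} (h : IsMonoidEnum E) (k : ℕ) :
    earlier (fun k => val (E k)) k = (E k).2 := by
  have h1 : ∀ i, i < k ∧ val (E i) = val (E k) ↔ ∃ j < (E k).2, E.symm ((E k).1, j) = i := by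
    intro i
    constructor
    · rintro ⟨hik, he⟩
      have he' : (E i).1 = (E k).1 := by simpa [val] using he
      refine ⟨(E i).2, ?_, by rw [← he']; simp⟩
      by_contra hn
      have := h.le_of_le he'.ge (not_lt.1 hn)
      simp at this
      omega
    · rintro ⟨j, hj, rfl⟩
      refine ⟨?_, by simp [val]⟩
      have := h.lt_of_lt (le_refl (E k).1) hj.le (Or.inr hj)
      simpa using this
  have h2 : ((Finset.range k).filter fun i => val (E i) = val (E k)) =
      (Finset.range (E k).2).image fun j => E.symm ((E k).1, j) := by
    ext i
    simpa using h1 i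
  rw [earlier, h2, Finset.card_image_of_injective, Finset.card_range]
  intro a b hab
  exact (Prod.mk.inj (E.symm.injective hab)).2

/-- Counting occurrences up to and including `k` gives the second coordinate plus one. The
prescribed start agrees with this rule, because the enumeration begins `(0, 0), …, (N + 1, 0), (0,
1)`. -/
theorem IsTypeOneEnum.typeTwo_eq {E : ℕ ≃ ℕ × ℕ} {N : ℕ} (h : IsTypeOneEnum E N) :
    typeTwo (N + 2) (fun k => val (E k)) = fun k => val (E.trans (Equiv.prodComm ℕ ℕ) k) := by
  funext k
  change _ = (E k).2 + 1
  rw [typeTwo]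
  split_ifs with h1 h2
  · rw [show E k = (k, 0) by rw [← E.eq_symm_apply, h.symm_of_le (by omega)]]
  · rw [show E k = (0, 1) by rw [← E.eq_symm_apply, h.symm_zero_one, h2]]
  · rw [Finset.range_add_one, Finset.filter_insert, if_pos rfl, Finset.card_insert_of_notMem
      (by simp)]
    exact congrArg (· + 1) (h.toIsMonoidEnum.earlier_val k)

/-- The number `n` is the least `v` with `(0, 1) < (v, 0)`; it is at least `2` because `(1, 0)`
precedes `(0, 1)`. -/
theorem IsMonoidEnum.exists_isTypeOneEnum {E : ℕ ≃ ℕ × ℕ} (h : IsMonoidEnum E)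
    (h1 : E.symm (1, 0) < E.symm (0, 1)) : ∃ N, IsTypeOneEnum E N := by
  have hex := exists_lt_symm E (0, 1)
  classical
  have h2 : 2 ≤ Nat.find hex := by
    by_contra hn
    have := h.le_of_le (show Nat.find hex ≤ 1 by omega) (le_refl 0)
    have := Nat.find_spec hex
    omega
  obtain ⟨N, hN⟩ := Nat.exists_eq_add_of_le' h2
  refine ⟨N, h, ?_, by rw [← hN]; exact Nat.find_spec hex⟩
  refine lt_of_le_of_ne (not_lt.1 (Nat.find_min hex (by omega))) fun he => ?_
  have := (Prod.mk.inj (E.symm.injective he)).1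
  omega

theorem IsDoublyFractal.isConstructed {S : ℕ → ℕ} (hS : IsDoublyFractal S) : IsConstructed S := by
  obtain ⟨E, hE, rfl⟩ := hS.exists_enum
  have hne : E.symm (1, 0) ≠ E.symm (0, 1) := fun he => by simpa using E.symm.injective he
  rcases lt_or_gt_of_ne hne with hlt | hlt
  · obtain ⟨N, hN⟩ := hE.exists_isTypeOneEnum hlt
    obtain ⟨c, hc⟩ := exists_choices_of_enum hN
    exact ⟨N + 2, by omega, c, Or.inl hc.symm⟩
  · obtain ⟨N, hN⟩ := hE.swap.exists_isTypeOneEnum hlt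
    obtain ⟨c, hc⟩ := exists_choices_of_enum hN
    refine ⟨N + 2, by omega, c, Or.inr ?_⟩
    rw [hc, hN.typeTwo_eq]
    rfl

theorem IsConstructed.isDoublyFractal {S : ℕ → ℕ} (hS : IsConstructed S) : IsDoublyFractal S := by
  obtain ⟨n, hn, c, hS⟩ := hS
  obtain ⟨N, rfl⟩ := Nat.exists_eq_add_of_le' hn
  obtain ⟨E, hE, hc⟩ := exists_enum_of_choices N c
  rcases hS with rfl | rfl
  · rw [hc]
    exact hE.isDoublyFractal
  · rw [hc, hE.typeTwo_eq]
    exact hE.swap.isDoublyFractal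

end DoublyFractal

theorem theorem9 :
    (∀ S : ℕ → ℕ, DoublyFractal.IsDoublyFractal S → DoublyFractal.IsConstructed S) ∧
      (∀ S : ℕ → ℕ, DoublyFractal.IsConstructed S → DoublyFractal.IsDoublyFractal S) :=
  ⟨fun _ h => h.isConstructed, fun _ h => h.isDoublyFractal⟩
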